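/- Let $k$ be a commutative ring; all algebras are commutative $k$-algebras, simplicial algebras consist of unital ones. Let $\mathbf E$ be a free simplicial algebra: for each $m\ge 1$ there is a family of generators in $E_m$, all of whose faces vanish except possibly $d_m$, such that each $E_n$ is the polynomial $E_0$-algebra on all (iterated) degeneracies in dimension $n$ of the generators of dimension $1\le m\le n$. Let $\mathbf E^{(j)}$ be its $j$-skeleton, the simplicial subalgebra generated by the simplices of dimension $\le j$. For a simplicial algebra $\mathbf X$ put $NX_n=\bigcap_{i<n}\ker d_i^n$, $\partial_n=d_n^n|_{NX_n}$, let $D_n\subseteq X_n$ be the subalgebra generated by the degenerate elements, and let $\mathbf C^{(2)}(\mathbf X)_2=NX_2/\partial_3(NX_3\cap D_3)$ be the degree-2 term of its 2-crossed complex, with $X_1$ acting through $s_1$ and with boundary to $X_1$ induced by $d_2$. A crossed $A$-module is a (non-unital) commutative $A$-algebra $C$ with an $A$-linear multiplicative map $\partial:C\to A$ such that $\partial(c)\cdot c'=cc'$. For ideals $J,I$ of $A$, $J\otimes I=J\otimes_A I$ has product $(n\otimes m)(n'\otimes m')=nn'\otimes mm'$ and boundary $n\otimes m\mapsto nm$.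 The coproduct $M\sqcup N$ of crossed $A$-modules, with injections $i,j$, is the quotient of the semidirect product $M\rtimes N$ by the ideal generated by the elements $pq-\partial(p)q$, where $\partial(m,n)=\partial m+\partial n$. (1) With $A=E^{(1)}_1$, there is an isomorphism of $A$-algebras, compatible with the boundaries to $A$, $$\ker d_1^1\otimes\ker d_0^1\;\cong\;\mathbf C^{(2)}(\mathbf E^{(1)})_2,\qquad y\otimes x\mapsto [\,s_1x\,(s_1y-s_0y)\,].$$ (2) With $A=E^{(2)}_1$, let $\partial:C\to A$ be the free crossed $A$-module on the function $t\mapsto d_2t$ from the set of generators of dimension $2$ to $A$. Then $\partial C\subseteq\ker d_0^1\cap\ker d_1^1$, and there is an isomorphism of $A$-algebras, compatible with the boundaries to $A$, $$\bigl((\ker d_1^1\otimes\ker d_0^1)\sqcup C\bigr)/\!\sim\;\;\cong\;\mathbf C^{(2)}(\mathbf E^{(2)})_2,$$ where $\sim$ is generated by $i(n\otimes\partial c)\sim j(n\cdot c)$ and $i(\partial c\otimes m)\sim j(m\cdot c)$ for $c\in C$, $n\in\ker d_1^1$, $m\in\ker d_0^1$. It sends the class of $i(y\otimes x)$ to $[\,s_1x(s_1y-s_0y)\,]$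 and the class of $j(t)$ to $[t]$ for each generator $t$ of dimension 2. -/

import Mathlib

open CategoryTheory Opposite Simplicial
open scoped TensorProduct

universe u v

namespace SimpAlg

/-! ### Crossed modules of commutative algebras -/

section CrossedModules

variable {A : Type v} [CommRing A]

/-- A crossed `A`-module: a (not necessarily unital) commutative `A`-algebra `C`, the `A`-module
structure being the action of `A` on `C`, with an `A`-equivariant multiplicative map `∂ : C → A`
such that `∂ c • c' = c * c'`. -/
def IsCrossedModule {C : Type v} [NonUnitalCommRing C] [Module A C] (bd : C →ₙₐ[A] A) : Prop :=
  ∀ c c' : C, bd c • c' = c * c'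

/-- `(C, ∂)` together with `ι : T → C` is the free crossed `A`-module on the function
`f : T → A`. -/
def IsFreeCrossedModule {T : Type v} (f : T → A) {C : Type v} [NonUnitalCommRing C] [Module A C]
    (bd : C →ₙₐ[A] A) (ι : T → C) : Prop :=
  IsCrossedModule bd ∧ (∀ t, bd (ι t) = f t) ∧
    ∀ (C' : Type v) [NonUnitalCommRing C'] [Module A C'] [IsScalarTower A C' C']
      [SMulCommClass A C' C'] (bd' : C' →ₙₐ[A] A) (g : T → C'),
      IsCrossedModule bd' → (∀ t, bd' (g t) = f t) →
        ∃! φ : C →ₙₐ[A] C', (∀ c, bd' (φ c) = bd c) ∧ ∀ t, φ (ι t) = g t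

/-- The crossed `A`-module given by an ideal of `A` and its inclusion. -/
def idealIncl (I : Ideal A) : I →ₙₐ[A] A where
  toFun x := x
  map_smul' _ _ := rfl
  map_zero' := rfl
  map_add' _ _ := rfl
  map_mul' _ _ := rfl

/-! ### Quotients of non-unital commutative algebras -/

/-- An ideal of a non-unital commutative `A`-algebra, stable under the action of `A`. -/
structure ActIdeal (A : Type v) [CommRing A] (P : Type v) [NonUnitalCommRing P] [Module A P]
    extends Submodule A P where
  mul_mem' : ∀ (p : P) (x : P), x ∈ toSubmodule → p * x ∈ toSubmodule

section Quotient

variable {P : Type v} [NonUnitalCommRing P] [Module A P]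

/-- The smallest `A`-stable ideal containing a set. -/
def actSpan (A : Type v) [CommRing A] {P : Type v} [NonUnitalCommRing P] [Module A P]
    (s : Set P) : ActIdeal A P where
  toSubmodule := sInf {N | s ⊆ (N : Set P) ∧ ∀ (p x : P), x ∈ N → p * x ∈ N}
  mul_mem' p x hx := by
    simp only [Submodule.mem_sInf, Set.mem_ofPred_eq] at hx ⊢
    exact fun N hN => hN.2 p x (hx N hN)

/-- The quotient `P / N` of an algebra by an `A`-stable ideal. -/
def ActIdeal.Quot (N : ActIdeal A P) : Type v := P ⧸ N.toSubmodule

namespace ActIdeal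

variable (N : ActIdeal A P)

instance : AddCommGroup N.Quot := inferInstanceAs (AddCommGroup (P ⧸ N.toSubmodule))
instance : Module A N.Quot := inferInstanceAs (Module A (P ⧸ N.toSubmodule))

/-- The projection `P → P / N`. -/
def proj (p : P) : N.Quot := Submodule.Quotient.mk p

theorem proj_eq {p q : P} : N.proj p = N.proj q ↔ p - q ∈ N.toSubmodule :=
  Submodule.Quotient.eq _

theorem proj_surj (x : N.Quot) : ∃ p, N.proj p = x := Submodule.Quotient.mk_surjective _ x

instance : Mul N.Quot where
  mul := Quotient.map₂ (· * ·) (by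
    intro a a' ha b b' hb
    have ha : a - a' ∈ N.toSubmodule := (Submodule.quotientRel_def _).1 ha
    have hb : b - b' ∈ N.toSubmodule := (Submodule.quotientRel_def _).1 hb
    refine (Submodule.quotientRel_def _).2 ?_
    have h : a * b - a' * b' = b * (a - a') + a' * (b - b') := by
      rw [mul_sub, mul_sub, mul_comm b a, mul_comm b a']; abel
    rw [h]
    exact N.toSubmodule.add_mem (N.mul_mem' _ _ ha) (N.mul_mem' _ _ hb))

theorem proj_mul (p q : P) : N.proj (p * q) = N.proj p * N.proj q := rfl
theorem proj_add (p q : P) : N.proj (p + q) = N.proj p + N.proj q := rfl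
theorem proj_smul (a : A) (p : P) : N.proj (a • p) = a • N.proj p := rfl
theorem proj_zero : N.proj 0 = 0 := rfl

instance : NonUnitalCommRing N.Quot where
  left_distrib x y z := by
    obtain ⟨x, rfl⟩ := N.proj_surj x
    obtain ⟨y, rfl⟩ := N.proj_surj y
    obtain ⟨z, rfl⟩ := N.proj_surj z
    simp only [← proj_mul, ← proj_add, mul_add]
  right_distrib x y z := by
    obtain ⟨x, rfl⟩ := N.proj_surj x
    obtain ⟨y, rfl⟩ := N.proj_surj y
    obtain ⟨z, rfl⟩ := N.proj_surj z
    simp only [← proj_mul, ← proj_add, add_mul]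
  zero_mul x := by
    obtain ⟨x, rfl⟩ := N.proj_surj x
    rw [← proj_zero, ← proj_mul, zero_mul]
  mul_zero x := by
    obtain ⟨x, rfl⟩ := N.proj_surj x
    rw [← proj_zero, ← proj_mul, mul_zero]
  mul_assoc x y z := by
    obtain ⟨x, rfl⟩ := N.proj_surj x
    obtain ⟨y, rfl⟩ := N.proj_surj y
    obtain ⟨z, rfl⟩ := N.proj_surj z
    simp only [← proj_mul, mul_assoc]
  mul_comm x y := by
    obtain ⟨x, rfl⟩ := N.proj_surj x
    obtain ⟨y, rfl⟩ := N.proj_surj y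
    simp only [← proj_mul, mul_comm]

/-- The map induced on the quotient by a map vanishing on the ideal. -/
def lift {Q : Type v} [NonUnitalCommRing Q] [Module A Q] (φ : P →ₙₐ[A] Q)
    (h : ∀ x ∈ N.toSubmodule, φ x = 0) : N.Quot →ₙₐ[A] Q where
  toFun := N.toSubmodule.liftQ (φ : P →ₗ[A] Q) (fun x hx => h x hx)
  map_smul' a x := map_smul _ a x
  map_zero' := map_zero _
  map_add' x y := map_add _ x y
  map_mul' x y := by
    obtain ⟨x, rfl⟩ := N.proj_surj x
    obtain ⟨y, rfl⟩ := N.proj_surj y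
    exact map_mul φ x y

end ActIdeal

/-- A map killing `s` and (equivariant, multiplicative) kills the ideal generated by `s`. -/
theorem actSpan_le_ker {Q : Type v} [NonUnitalCommRing Q] [Module A Q] (φ : P →ₙₐ[A] Q)
    {s : Set P} (h : ∀ x ∈ s, φ x = 0) : ∀ x ∈ (actSpan A s).toSubmodule, φ x = 0 := by
  intro x hx
  refine (Submodule.mem_sInf.1 hx) (LinearMap.ker (φ : P →ₗ[A] Q)) ⟨fun y hy => h y hy, ?_⟩
  intro p y hy
  have hy : φ y = 0 := hy
  change φ (p * y) = 0
  rw [map_mul, hy, mul_zero]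

end Quotient

/-! ### Tensor product of crossed modules -/

section Tensor

variable {M N : Type v} [NonUnitalCommRing M] [Module A M] [IsScalarTower A M M]
  [SMulCommClass A M M] [NonUnitalCommRing N] [Module A N] [IsScalarTower A N N]
  [SMulCommClass A N N]

instance : NonUnitalCommRing (M ⊗[A] N) where
  mul_comm x y := by
    induction x with
    | zero => rw [zero_mul, mul_zero]
    | add a b ha hb => rw [add_mul, mul_add, ha, hb]
    | tmul m n =>
      induction y with
      | zero => rw [zero_mul, mul_zero]
      | add a b ha hb => rw [add_mul, mul_add, ha, hb]
      | tmul m' n' =>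
        rw [Algebra.TensorProduct.tmul_mul_tmul, Algebra.TensorProduct.tmul_mul_tmul,
          mul_comm m, mul_comm n]

/-- The boundary `M ⊗ N → A`, `m ⊗ n ↦ ∂ m * ∂ n`, of the tensor product of two crossed
`A`-modules. The product of `M ⊗ N` is `(m ⊗ n) * (m' ⊗ n') = (m * m') ⊗ (n * n')`. -/
def tensorBd (bd₁ : M →ₙₐ[A] A) (bd₂ : N →ₙₐ[A] A) : M ⊗[A] N →ₙₐ[A] A where
  toFun := TensorProduct.lift ((LinearMap.mul A A).compl₁₂ (bd₁ : M →ₗ[A] A) (bd₂ : N →ₗ[A] A))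
  map_smul' a x := map_smul _ a x
  map_zero' := map_zero _
  map_add' x y := map_add _ x y
  map_mul' x y := by
    induction x with
    | zero => rw [zero_mul, map_zero, zero_mul]
    | add a b ha hb => rw [add_mul, map_add, map_add, ha, hb, add_mul]
    | tmul m n =>
      induction y with
      | zero => rw [mul_zero, map_zero, mul_zero]
      | add a b ha hb => rw [mul_add, map_add, map_add, ha, hb, mul_add]
      | tmul m' n' =>
        have h : bd₁ (m * m') * bd₂ (n * n') = bd₁ m * bd₂ n * (bd₁ m' * bd₂ n') := by
          rw [map_mul, map_mul, mul_mul_mul_comm]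
        simpa using h

end Tensor

/-! ### Coproduct of crossed modules -/

section Coproduct

variable {M N : Type v} [NonUnitalCommRing M] [Module A M] [IsScalarTower A M M]
  [SMulCommClass A M M] [NonUnitalCommRing N] [Module A N] [IsScalarTower A N N]
  [SMulCommClass A N N]

/-- The semidirect product `M ⋊ N`, where `M` acts on `N` through `∂ : M → A`. -/
@[ext] structure Semi (bd₁ : M →ₙₐ[A] A) (N : Type v) where
  fst : M
  snd : N

namespace Semi

variable {bd₁ : M →ₙₐ[A] A}

/-- The underlying set of `M ⋊ N` is `M × N`. -/
def equivProd (bd₁ : M →ₙₐ[A] A) (N : Type v) : Semi bd₁ N ≃ M × N where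
  toFun p := (p.fst, p.snd)
  invFun p := ⟨p.1, p.2⟩

instance : AddCommGroup (Semi bd₁ N) := (equivProd bd₁ N).addCommGroup
instance : Module A (Semi bd₁ N) := (equivProd bd₁ N).module A

instance : Mul (Semi bd₁ N) where
  mul p q := ⟨p.fst * q.fst, bd₁ q.fst • p.snd + bd₁ p.fst • q.snd + p.snd * q.snd⟩

@[simp] theorem fst_add (p q : Semi bd₁ N) : (p + q).fst = p.fst + q.fst := rfl
@[simp] theorem snd_add (p q : Semi bd₁ N) : (p + q).snd = p.snd + q.snd := rfl
@[simp] theorem fst_zero : (0 : Semi bd₁ N).fst = 0 := rfl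
@[simp] theorem snd_zero : (0 : Semi bd₁ N).snd = 0 := rfl
@[simp] theorem fst_smul (a : A) (p : Semi bd₁ N) : (a • p).fst = a • p.fst := rfl
@[simp] theorem snd_smul (a : A) (p : Semi bd₁ N) : (a • p).snd = a • p.snd := rfl
@[simp] theorem fst_mul (p q : Semi bd₁ N) : (p * q).fst = p.fst * q.fst := rfl
@[simp] theorem snd_mul (p q : Semi bd₁ N) :
    (p * q).snd = bd₁ q.fst • p.snd + bd₁ p.fst • q.snd + p.snd * q.snd := rfl

instance : NonUnitalCommRing (Semi bd₁ N) where
  left_distrib x y z := by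
    ext
    · simp [mul_add]
    · simp only [snd_mul, snd_add, fst_add, map_add, add_smul, smul_add, mul_add]; abel
  right_distrib x y z := by
    ext
    · simp [add_mul]
    · simp only [snd_mul, snd_add, fst_add, map_add, add_smul, smul_add, add_mul]; abel
  zero_mul x := by ext <;> simp
  mul_zero x := by ext <;> simp
  mul_assoc x y z := by
    ext
    · simp [mul_assoc]
    · simp only [snd_mul, fst_mul, map_mul, smul_add, add_mul, mul_add, mul_smul, mul_assoc,
        smul_mul_assoc, mul_smul_comm]
      rw [smul_comm (bd₁ z.fst) (bd₁ y.fst), smul_comm (bd₁ z.fst) (bd₁ x.fst)]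
      abel
  mul_comm x y := by
    ext
    · simp [mul_comm]
    · simp only [snd_mul, mul_comm x.snd]; abel

/-- `(m, n) ↦ ∂₁ m + ∂₂ n` on `M ⋊ N`. -/
def bd (bd₁ : M →ₙₐ[A] A) (bd₂ : N →ₙₐ[A] A) : Semi bd₁ N →ₙₐ[A] A where
  toFun p := bd₁ p.fst + bd₂ p.snd
  map_smul' a x := by
    simp only [fst_smul, snd_smul, map_smul, smul_add, MonoidHom.id_apply]
  map_zero' := by simp
  map_add' x y := by simp only [fst_add, snd_add, map_add]; abel
  map_mul' x y := by simp only [fst_mul, snd_mul, map_mul, map_add, map_smul, smul_eq_mul]; ring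

end Semi

/-- The Peiffer ideal of `M ⋊ N`. -/
def coprodPeiffer (bd₁ : M →ₙₐ[A] A) (bd₂ : N →ₙₐ[A] A) : ActIdeal A (Semi bd₁ N) :=
  actSpan A {x | ∃ p q : Semi bd₁ N, x = p * q - Semi.bd bd₁ bd₂ p • q}

/-- The coproduct `M ⊔ N = (M ⋊ N) / P` of two crossed `A`-modules. -/
abbrev Coprod (bd₁ : M →ₙₐ[A] A) (bd₂ : N →ₙₐ[A] A) : Type v := (coprodPeiffer bd₁ bd₂).Quot

namespace Coprod

variable (bd₁ : M →ₙₐ[A] A) (bd₂ : N →ₙₐ[A] A)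

/-- The injection `i : M → M ⊔ N`. -/
def inl (m : M) : Coprod bd₁ bd₂ := (coprodPeiffer bd₁ bd₂).proj ⟨m, 0⟩

/-- The injection `j : N → M ⊔ N`. -/
def inr (n : N) : Coprod bd₁ bd₂ := (coprodPeiffer bd₁ bd₂).proj ⟨0, n⟩

/-- The boundary `M ⊔ N → A` induced by `∂₁ m + ∂₂ n`. -/
def bd : Coprod bd₁ bd₂ →ₙₐ[A] A :=
  (coprodPeiffer bd₁ bd₂).lift (Semi.bd bd₁ bd₂) (actSpan_le_ker _ (by
    rintro _ ⟨p, q, rfl⟩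
    rw [map_sub, map_mul, map_smul, smul_eq_mul, sub_self]))

end Coprod

end Coproduct

/-! ### Adjoining a crossed module to a tensor product of ideals -/

section Adjoin

variable (J I : Ideal A) {C : Type v} [NonUnitalCommRing C] [Module A C] [IsScalarTower A C C]
  [SMulCommClass A C C] (bdC : C →ₙₐ[A] A)

/-- The boundary `J ⊗ I → A`, `y ⊗ x ↦ y * x`. -/
abbrev idealTensorBd : (J ⊗[A] I) →ₙₐ[A] A := tensorBd (idealIncl J) (idealIncl I)

/-- The ideal of `(J ⊗ I) ⊔ C` generated by the relations
`i (n ⊗ ∂ c) ∼ j (n • c)` and `i (∂ c ⊗ m) ∼ j (m • c)` for `n ∈ J`, `m ∈ I`, `c ∈ C`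
(here `∂ C ⊆ J ∩ I`). -/
def adjoinRel (hJ : ∀ c, bdC c ∈ J) (hI : ∀ c, bdC c ∈ I) :
    ActIdeal A (Coprod (idealTensorBd J I) bdC) :=
  actSpan A
    ({z | ∃ (c : C) (n : J), z = Coprod.inl (idealTensorBd J I) bdC (n ⊗ₜ[A] ⟨bdC c, hI c⟩) -
        Coprod.inr (idealTensorBd J I) bdC ((n : A) • c)} ∪
     {z | ∃ (c : C) (m : I), z = Coprod.inl (idealTensorBd J I) bdC (⟨bdC c, hJ c⟩ ⊗ₜ[A] m) -
        Coprod.inr (idealTensorBd J I) bdC ((m : A) • c)})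

/-- The algebra `((J ⊗ I) ⊔ C) / ∼`. -/
abbrev Adjoin (hJ : ∀ c, bdC c ∈ J) (hI : ∀ c, bdC c ∈ I) : Type v := (adjoinRel J I bdC hJ hI).Quot

/-- The class of `i (t)`, for `t ∈ J ⊗ I`. -/
def Adjoin.inl (hJ : ∀ c, bdC c ∈ J) (hI : ∀ c, bdC c ∈ I) (t : J ⊗[A] I) :
    Adjoin J I bdC hJ hI :=
  (adjoinRel J I bdC hJ hI).proj (Coprod.inl (idealTensorBd J I) bdC t)

/-- The class of `j (c)`, for `c ∈ C`. -/
def Adjoin.inr (hJ : ∀ c, bdC c ∈ J) (hI : ∀ c, bdC c ∈ I) (c : C) :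
    Adjoin J I bdC hJ hI :=
  (adjoinRel J I bdC hJ hI).proj (Coprod.inr (idealTensorBd J I) bdC c)

/-- The boundary `((J ⊗ I) ⊔ C) / ∼ → A`. -/
def Adjoin.bd (hJ : ∀ c, bdC c ∈ J) (hI : ∀ c, bdC c ∈ I) : Adjoin J I bdC hJ hI →ₙₐ[A] A :=
  (adjoinRel J I bdC hJ hI).lift (Coprod.bd (idealTensorBd J I) bdC) (actSpan_le_ker _ (by
    have hl : ∀ t, Coprod.bd (idealTensorBd J I) bdC (Coprod.inl (idealTensorBd J I) bdC t) =
        idealTensorBd J I t := fun t => by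
      change idealTensorBd J I t + bdC 0 = _
      rw [map_zero, add_zero]
    have hr : ∀ c, Coprod.bd (idealTensorBd J I) bdC (Coprod.inr (idealTensorBd J I) bdC c) =
        bdC c := fun c => by
      change idealTensorBd J I 0 + bdC c = _
      rw [map_zero, zero_add]
    rintro _ (⟨c, n, rfl⟩ | ⟨c, m, rfl⟩)
    · rw [map_sub, hl, hr, map_smul, smul_eq_mul]
      exact sub_self ((n : A) * bdC c)
    · rw [map_sub, hl, hr, map_smul, smul_eq_mul, mul_comm]
      exact sub_self (bdC c * (m : A))))

end Adjoin

end CrossedModules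

/-! ### Simplicial commutative algebras -/

variable {k : Type u} [CommRing k]

/-- Face maps of a simplicial commutative `k`-algebra. -/
abbrev face (E : SimplicialObject (CommAlgCat.{v} k)) {n : ℕ} (i : Fin (n + 2)) :
    E _⦋n + 1⦌ →ₐ[k] E _⦋n⦌ := (E.δ i).hom

/-- Degeneracy maps of a simplicial commutative `k`-algebra. -/
abbrev degen (E : SimplicialObject (CommAlgCat.{v} k)) {n : ℕ} (i : Fin (n + 1)) :
    E _⦋n⦌ →ₐ[k] E _⦋n + 1⦌ := (E.σ i).hom

/-- Data exhibiting `E` as a free simplicial algebra (`step-by-step' construction): for every `m`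
a family of new generators in dimension `m + 1`, all of whose faces except the last vanish, such
that each `Eₙ` is the polynomial `E₀`-algebra on all the iterated degeneracies (including the
identical one) of the generators. -/
structure FreeData (E : SimplicialObject (CommAlgCat.{v} k)) where
  gen : ℕ → Type v
  ι : ∀ {m : ℕ}, gen m → E _⦋m + 1⦌
  face_ι : ∀ {m : ℕ} (x : gen m) (i : Fin (m + 2)), i ≠ Fin.last (m + 1) → face E i (ι x) = 0
  free : ∀ n : ℕ, Function.Bijective
    (MvPolynomial.eval₂Hom
      (E.map (SimplexCategory.const ⦋n⦌ ⦋0⦌ 0).op).hom.toRingHom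
      (fun p : (Σ m : ℕ, {s : ⦋n⦌ ⟶ ⦋m + 1⦌ // Epi s} × gen m) =>
        (E.map p.2.1.1.op).hom (ι p.2.2)))

/-- In degree `n`, the subalgebra of `Eₙ` generated by the images of the simplices of
dimension `≤ j`. -/
def skeletonAlg (E : SimplicialObject (CommAlgCat.{v} k)) (j : ℕ) (X : SimplexCategoryᵒᵖ) :
    Subalgebra k (E.obj X) :=
  Algebra.adjoin k {z | ∃ (i : ℕ) (_ : i ≤ j) (s : X.unop ⟶ ⦋i⦌) (y : E _⦋i⦌),
    (E.map s.op).hom y = z}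

theorem skeletonAlg_map (E : SimplicialObject (CommAlgCat.{v} k)) (j : ℕ)
    {X Y : SimplexCategoryᵒᵖ} (f : X ⟶ Y) (z : E.obj X) (hz : z ∈ skeletonAlg E j X) :
    (E.map f).hom z ∈ skeletonAlg E j Y := by
  have h : skeletonAlg E j X ≤ (skeletonAlg E j Y).comap (E.map f).hom := by
    refine Algebra.adjoin_le ?_
    rintro _ ⟨i, hi, s, y, rfl⟩
    refine Algebra.subset_adjoin ⟨i, hi, f.unop ≫ s, y, ?_⟩
    rw [op_comp, E.map_comp]
    rfl
  exact h hz

/-- The `j`-skeleton of a (free) simplicial algebra, as the simplicial subalgebra generated by the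
simplices of dimension `≤ j`. -/
def skeleton (E : SimplicialObject (CommAlgCat.{v} k)) (j : ℕ) :
    SimplicialObject (CommAlgCat.{v} k) where
  obj X := CommAlgCat.of k (skeletonAlg E j X)
  map {X Y} f := CommAlgCat.ofHom
    (((E.map f).hom.comp (skeletonAlg E j X).val).codRestrict (skeletonAlg E j Y)
      (fun z => skeletonAlg_map E j f z z.2))
  map_id X := by
    ext z
    change (E.map (𝟙 X)).hom (z : E.obj X) = z
    rw [E.map_id]
    rfl
  map_comp f g := by
    ext z
    change (E.map (f ≫ g)).hom (z : E.obj _) = (E.map g).hom ((E.map f).hom (z : E.obj _))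
    rw [E.map_comp]
    rfl

/-- A simplex of dimension `i ≤ j`, seen as a simplex of the `j`-skeleton. -/
def toSkeleton (E : SimplicialObject (CommAlgCat.{v} k)) {i j : ℕ} (h : i ≤ j) (y : E _⦋i⦌) :
    skeleton E j _⦋i⦌ :=
  ⟨y, Algebra.subset_adjoin ⟨i, h, 𝟙 _, y, by rw [op_id, E.map_id]; rfl⟩⟩

section TwoCrossed

variable (E : SimplicialObject (CommAlgCat.{v} k))

/-- `Ker dᵢ¹`, an ideal of `E₁`. -/
abbrev kerFace (i : Fin 2) : Ideal (E _⦋1⦌) := RingHom.ker (face E i)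

/-- The term `NE_{n+1} = ⋂_{i ≤ n} Ker dᵢ` of the Moore complex, an ideal of `E_{n+1}`. -/
def moore (n : ℕ) : Ideal (E _⦋n + 1⦌) := ⨅ i : Fin (n + 1), RingHom.ker (face E i.castSucc)

/-- `D_{n+1}`, the subalgebra of `E_{n+1}` generated by the degenerate elements. -/
def degenerate (n : ℕ) : Subalgebra k (E _⦋n + 1⦌) :=
  Algebra.adjoin k {z | ∃ (i : Fin (n + 1)) (y : E _⦋n⦌), degen E i y = z}

theorem mem_moore {n : ℕ} {x : E _⦋n + 1⦌} :
    x ∈ moore E n ↔ ∀ i : Fin (n + 1), face E i.castSucc x = 0 := by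
  simp [moore, RingHom.mem_ker]

/-- `∂₃(NE₃ ∩ D₃)`, an ideal of `E₂`. -/
def boundaryIdeal : Ideal (E _⦋2⦌) where
  carrier := {z | ∃ w ∈ moore E 2, w ∈ degenerate E 2 ∧ face E (Fin.last 3) w = z}
  add_mem' := by
    rintro _ _ ⟨w, h, h', rfl⟩ ⟨w₂, h₂, h₂', rfl⟩
    exact ⟨w + w₂, add_mem h h₂, add_mem h' h₂', map_add _ _ _⟩
  zero_mem' := ⟨0, zero_mem _, zero_mem _, map_zero _⟩
  smul_mem' := by
    rintro c _ ⟨w, h, h', rfl⟩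
    refine ⟨degen E (Fin.last 2) c * w, Ideal.mul_mem_left _ _ h,
      mul_mem (Algebra.subset_adjoin ⟨_, c, rfl⟩) h', ?_⟩
    rw [map_mul]
    have h1 : face E (Fin.last 3) (degen E (Fin.last 2) c) = c := by
      have := E.δ_comp_σ_succ (i := Fin.last 2)
      exact congrArg (fun f => f.hom c) this
    rw [h1, smul_eq_mul]

/-- `NE₂ / ∂₃(NE₃ ∩ D₃)`, as the image of the ideal `NE₂` in `E₂ / ∂₃(NE₃ ∩ D₃)`. -/
def c2Ideal : Ideal (E _⦋2⦌ ⧸ boundaryIdeal E) :=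
  (moore E 1).map (Ideal.Quotient.mk (boundaryIdeal E))

/-- The degree-two term `NE₂ / ∂₃(NE₃ ∩ D₃)` of the 2-crossed complex of `E`. -/
def C2 : Type v := c2Ideal E

namespace C2

instance : NonUnitalCommRing (C2 E) := inferInstanceAs (NonUnitalCommRing (c2Ideal E))

/-- The class of an element of `NE₂`. -/
def mk (z : E _⦋2⦌) (hz : z ∈ moore E 1) : C2 E :=
  ⟨Ideal.Quotient.mk _ z, Ideal.mem_map_of_mem _ hz⟩

/-- `E₁` acts on `NE₂ / ∂₃(NE₃ ∩ D₃)` by multiplication through `s₁`. -/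
instance : Module (E _⦋1⦌) (C2 E) :=
  letI : Module (E _⦋2⦌ ⧸ boundaryIdeal E) (C2 E) :=
    inferInstanceAs (Module (E _⦋2⦌ ⧸ boundaryIdeal E) (c2Ideal E))
  Module.compHom (C2 E)
    ((Ideal.Quotient.mk (boundaryIdeal E)).comp (degen E (1 : Fin 2)).toRingHom)

theorem face_boundaryIdeal (z : E _⦋2⦌) (hz : z ∈ boundaryIdeal E) :
    face E (Fin.last 2) z = 0 := by
  obtain ⟨w, h, -, rfl⟩ := hz
  have h2 : face E (Fin.last 2).castSucc w = 0 := (mem_moore E).1 h _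
  have := E.δ_comp_δ_self (i := Fin.last 2)
  have h3 : face E (Fin.last 2) (face E (Fin.last 2).castSucc w) =
      face E (Fin.last 2) (face E (Fin.last 2).succ w) := congrArg (fun f => f.hom w) this
  rw [h2, map_zero] at h3
  exact h3.symm

/-- The boundary `∂₂ : NE₂ / ∂₃(NE₃ ∩ D₃) → E₁`, induced by `d₂`. -/
def bd : C2 E →ₙₐ[E _⦋1⦌] E _⦋1⦌ where
  toFun z := Ideal.Quotient.lift (boundaryIdeal E) (face E (Fin.last 2)).toRingHom
    (face_boundaryIdeal E) z.1
  map_smul' a z := by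
    have h1 : face E (Fin.last 2) (degen E (1 : Fin 2) a) = a := by
      have := E.δ_comp_σ_succ (i := (1 : Fin 2))
      exact congrArg (fun f => f.hom a) this
    obtain ⟨z, hz⟩ := z
    obtain ⟨y, rfl⟩ := Ideal.Quotient.mk_surjective z
    change face E (Fin.last 2) (degen E (1 : Fin 2) a * y) = a * face E (Fin.last 2) y
    rw [map_mul, h1]
  map_zero' := map_zero _
  map_add' x y := map_add _ x.1 y.1
  map_mul' x y := map_mul _ x.1 y.1

/-- For `x ∈ Ker d₀` and `y ∈ Ker d₁` in `E₁`, the element `s₁ x * (s₁ y - s₀ y)` is in `NE₂`. -/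
theorem pairing_mem (x : kerFace E 0) (y : kerFace E 1) :
    degen E (1 : Fin 2) (x : E _⦋1⦌) *
      (degen E (1 : Fin 2) (y : E _⦋1⦌) - degen E (0 : Fin 2) (y : E _⦋1⦌)) ∈ moore E 1 := by
  rw [mem_moore]
  intro i
  rw [map_mul, map_sub]
  fin_cases i
  · have h : face E (0 : Fin 3) (degen E (1 : Fin 2) (x : E _⦋1⦌)) =
        degen E (0 : Fin 1) (face E (0 : Fin 2) (x : E _⦋1⦌)) :=
      congrArg (fun f => f.hom (x : E _⦋1⦌))
        (E.δ_comp_σ_of_le (i := (0 : Fin 2)) (j := (0 : Fin 1)) (le_refl _))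
    have hx : face E (0 : Fin 2) (x : E _⦋1⦌) = 0 := x.2
    rw [hx, map_zero] at h
    exact mul_eq_zero_of_left h _
  · have h1 : face E (1 : Fin 3) (degen E (1 : Fin 2) (y : E _⦋1⦌)) = y :=
      congrArg (fun f => f.hom (y : E _⦋1⦌)) (E.δ_comp_σ_self (i := (1 : Fin 2)))
    have h0 : face E (1 : Fin 3) (degen E (0 : Fin 2) (y : E _⦋1⦌)) = y :=
      congrArg (fun f => f.hom (y : E _⦋1⦌)) (E.δ_comp_σ_succ (i := (0 : Fin 2)))
    exact mul_eq_zero_of_right _ (by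
      change face E (1 : Fin 3) _ - face E (1 : Fin 3) _ = 0
      rw [h1, h0, sub_self])

/-- The pairing `h(x, y) = s₁ x * (s₁ y - s₀ y) + ∂₃(NE₃ ∩ D₃)` for `x ∈ Ker d₀`, `y ∈ Ker d₁`. -/
def pairing (x : kerFace E 0) (y : kerFace E 1) : C2 E := mk E _ (pairing_mem E x y)

end C2

end TwoCrossed

namespace FreeData

variable {E : SimplicialObject (CommAlgCat.{v} k)} (F : FreeData E)

/-- A generator of dimension two, in the 2-skeleton. -/
def gen₂ (t : F.gen 1) : skeleton E 2 _⦋2⦌ := toSkeleton E le_rfl (F.ι t)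

theorem gen₂_mem (t : F.gen 1) : F.gen₂ t ∈ moore (skeleton E 2) 1 := by
  rw [mem_moore]
  intro i
  refine Subtype.ext ?_
  exact F.face_ι t i.castSucc (Fin.castSucc_lt_last i).ne

end FreeData

end SimpAlg

namespace SimpAlg

/-!
Write `X` for either skeleton, `R = X₀` and `A = X₁`. Freeness makes `X₂` the polynomial algebra on
the generators `t` of dimension two over `A ⊗[R] A`, the two copies of `A` being embedded by `s₁` and
`s₀`.

Surjectivity: modulo the ideal generated by `s₁ (Ker d₀)` and the `t`, every `z ∈ X₂` is congruent
to `s₀ d₀ z`, so this ideal contains `NX₂`. Replacing `z` by `z - s₁ d₁ z` turns this description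
into one of `NX₂` itself: modulo `∂₃(NX₃ ∩ D₃)` it is spanned by the products `s₁ x (s₁ y - s₀ y)`
and `s₁ a · t`.

Injectivity: the same argument in `D₃` shows that `∂₃(NX₃ ∩ D₃)` is contained in the additive span of
three explicit families of products. Let `θ : X₂ → A ⊗[R] A` kill every `t`, let `μ` map `a ⊗ b` to
`(b - s₀ d₁ b) ⊗ (a - s₀ d₀ a)`, and let `Φ : X₂ → A ⊕ C` send `s₁ a` to `a`, `s₀ a` to `s₀ d₁ a` and
`t` to its image in `C`. The additive map `z ↦ j (pr_C (Φ z)) - i (μ (θ z))` kills the three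
families and sends `s₁ x (s₁ y - s₀ y)` to `i (y ⊗ x)` and `s₁ a · t` to `j (a · t)`, so it is a left
inverse.
-/

section SimplicialIdentities

variable {k : Type u} [CommRing k] (X : SimplicialObject (CommAlgCat.{v} k)) {n : ℕ}

theorem face_castSucc_degen (i : Fin (n + 1)) (z : X _⦋n⦌) :
    face X i.castSucc (degen X i z) = z :=
  congrArg (fun f => f.hom z) (X.δ_comp_σ_self (i := i))

theorem face_succ_degen (i : Fin (n + 1)) (z : X _⦋n⦌) : face X i.succ (degen X i z) = z :=
  congrArg (fun f => f.hom z) (X.δ_comp_σ_succ (i := i))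

theorem face_castSucc_degen_succ {i : Fin (n + 2)} {j : Fin (n + 1)} (h : i ≤ j.castSucc)
    (z : X _⦋n + 1⦌) : face X i.castSucc (degen X j.succ z) = degen X j (face X i z) :=
  congrArg (fun f => f.hom z) (X.δ_comp_σ_of_le h)

theorem face_succ_degen_castSucc {i : Fin (n + 2)} {j : Fin (n + 1)} (h : j.castSucc < i)
    (z : X _⦋n + 1⦌) : face X i.succ (degen X j.castSucc z) = degen X j (face X i z) :=
  congrArg (fun f => f.hom z) (X.δ_comp_σ_of_gt h)

theorem face_face_succ {i j : Fin (n + 2)} (h : i ≤ j) (z : X _⦋n + 2⦌) :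
    face X i (face X j.succ z) = face X j (face X i.castSucc z) :=
  congrArg (fun f => f.hom z) (X.δ_comp_δ h)

theorem degen_succ_degen {i j : Fin (n + 1)} (h : i ≤ j) (z : X _⦋n⦌) :
    degen X j.succ (degen X i z) = degen X i.castSucc (degen X j z) :=
  (congrArg (fun f => f.hom z) (X.σ_comp_σ h)).symm

@[simp] theorem face_zero_degen_zero (z : X _⦋n⦌) :
    face X (0 : Fin (n + 2)) (degen X (0 : Fin (n + 1)) z) = z :=
  face_castSucc_degen X 0 z

@[simp] theorem face_one_degen_zero (z : X _⦋n⦌) :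
    face X (1 : Fin (n + 2)) (degen X (0 : Fin (n + 1)) z) = z :=
  face_succ_degen X 0 z

@[simp] theorem face_one_degen_one (z : X _⦋n + 1⦌) :
    face X (1 : Fin (n + 3)) (degen X (1 : Fin (n + 2)) z) = z :=
  face_castSucc_degen X 1 z

@[simp] theorem face_two_degen_one (z : X _⦋n + 1⦌) :
    face X (2 : Fin (n + 3)) (degen X (1 : Fin (n + 2)) z) = z :=
  face_succ_degen X 1 z

@[simp] theorem face_two_degen_two (z : X _⦋n + 2⦌) :
    face X (2 : Fin (n + 4)) (degen X (2 : Fin (n + 3)) z) = z :=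
  face_castSucc_degen X 2 z

@[simp] theorem face_three_degen_two (z : X _⦋n + 2⦌) :
    face X (3 : Fin (n + 4)) (degen X (2 : Fin (n + 3)) z) = z :=
  face_succ_degen X 2 z

@[simp] theorem face_zero_degen_one (z : X _⦋n + 1⦌) :
    face X (0 : Fin (n + 3)) (degen X (1 : Fin (n + 2)) z) =
      degen X (0 : Fin (n + 1)) (face X (0 : Fin (n + 2)) z) :=
  face_castSucc_degen_succ X (i := 0) (j := 0) le_rfl z

@[simp] theorem face_zero_degen_two (z : X _⦋n + 2⦌) :
    face X (0 : Fin (n + 4)) (degen X (2 : Fin (n + 3)) z) =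
      degen X (1 : Fin (n + 2)) (face X (0 : Fin (n + 3)) z) :=
  face_castSucc_degen_succ X (i := 0) (j := 1) (Fin.zero_le _) z

@[simp] theorem face_one_degen_two (z : X _⦋n + 2⦌) :
    face X (1 : Fin (n + 4)) (degen X (2 : Fin (n + 3)) z) =
      degen X (1 : Fin (n + 2)) (face X (1 : Fin (n + 3)) z) :=
  face_castSucc_degen_succ X (i := 1) (j := 1) le_rfl z

@[simp] theorem face_two_degen_zero (z : X _⦋n + 1⦌) :
    face X (2 : Fin (n + 3)) (degen X (0 : Fin (n + 2)) z) =
      degen X (0 : Fin (n + 1)) (face X (1 : Fin (n + 2)) z) :=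
  face_succ_degen_castSucc X (i := 1) (j := 0) Nat.zero_lt_one z

@[simp] theorem face_three_degen_zero (z : X _⦋n + 2⦌) :
    face X (3 : Fin (n + 4)) (degen X (0 : Fin (n + 3)) z) =
      degen X (0 : Fin (n + 2)) (face X (2 : Fin (n + 3)) z) :=
  face_succ_degen_castSucc X (n := n + 1) (i := 2) (j := 0) Nat.zero_lt_two z

@[simp] theorem face_three_degen_one (z : X _⦋n + 2⦌) :
    face X (3 : Fin (n + 4)) (degen X (1 : Fin (n + 3)) z) =
      degen X (1 : Fin (n + 2)) (face X (2 : Fin (n + 3)) z) :=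
  face_succ_degen_castSucc X (n := n + 1) (i := 2) (j := 1) Nat.one_lt_two z

theorem face_zero_face_two (z : X _⦋n + 2⦌) :
    face X (0 : Fin (n + 2)) (face X (2 : Fin (n + 3)) z) =
      face X (1 : Fin (n + 2)) (face X (0 : Fin (n + 3)) z) :=
  face_face_succ X (i := 0) (j := 1) (Fin.zero_le _) z

theorem face_one_face_two (z : X _⦋n + 2⦌) :
    face X (1 : Fin (n + 2)) (face X (2 : Fin (n + 3)) z) =
      face X (1 : Fin (n + 2)) (face X (1 : Fin (n + 3)) z) :=
  face_face_succ X (i := 1) (j := 1) le_rfl z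

theorem face_one_face_three (z : X _⦋n + 3⦌) :
    face X (1 : Fin (n + 3)) (face X (3 : Fin (n + 4)) z) =
      face X (2 : Fin (n + 3)) (face X (1 : Fin (n + 4)) z) :=
  face_face_succ X (n := n + 1) (i := 1) (j := 2) (Nat.le_succ 1) z

theorem face_two_face_three (z : X _⦋n + 3⦌) :
    face X (2 : Fin (n + 3)) (face X (3 : Fin (n + 4)) z) =
      face X (2 : Fin (n + 3)) (face X (2 : Fin (n + 4)) z) :=
  face_face_succ X (i := 2) (j := 2) le_rfl z

theorem degen_one_degen_zero (z : X _⦋n⦌) :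
    degen X (1 : Fin (n + 2)) (degen X (0 : Fin (n + 1)) z) =
      degen X (0 : Fin (n + 2)) (degen X (0 : Fin (n + 1)) z) :=
  degen_succ_degen X (i := 0) (j := 0) le_rfl z

theorem degen_two_degen_zero (z : X _⦋n + 1⦌) :
    degen X (2 : Fin (n + 3)) (degen X (0 : Fin (n + 2)) z) =
      degen X (0 : Fin (n + 3)) (degen X (1 : Fin (n + 2)) z) :=
  degen_succ_degen X (i := 0) (j := 1) (Fin.zero_le _) z

theorem degen_two_degen_one (z : X _⦋n + 1⦌) :
    degen X (2 : Fin (n + 3)) (degen X (1 : Fin (n + 2)) z) =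
      degen X (1 : Fin (n + 3)) (degen X (1 : Fin (n + 2)) z) :=
  degen_succ_degen X (i := 1) (j := 1) le_rfl z

end SimplicialIdentities

section BoundaryIdeal

variable {k : Type u} [CommRing k] {X : SimplicialObject (CommAlgCat.{v} k)}

theorem mem_moore_one_iff {z : X _⦋2⦌} :
    z ∈ moore X 1 ↔ face X (0 : Fin 3) z = 0 ∧ face X (1 : Fin 3) z = 0 := by
  rw [mem_moore, Fin.forall_fin_two]
  rfl

theorem mem_moore_two_iff {w : X _⦋3⦌} :
    w ∈ moore X 2 ↔
      face X (0 : Fin 4) w = 0 ∧ face X (1 : Fin 4) w = 0 ∧ face X (2 : Fin 4) w = 0 := by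
  rw [mem_moore, Fin.forall_fin_succ, Fin.forall_fin_two]
  rfl

theorem degen_mem_degenerate {n : ℕ} (i : Fin (n + 1)) (z : X _⦋n⦌) :
    degen X i z ∈ degenerate X n :=
  Algebra.subset_adjoin ⟨i, z, rfl⟩

theorem face_three_mem_boundaryIdeal {w : X _⦋3⦌} (hw : w ∈ degenerate X 2)
    (h : face X (0 : Fin 4) w = 0 ∧ face X (1 : Fin 4) w = 0 ∧ face X (2 : Fin 4) w = 0) :
    face X (3 : Fin 4) w ∈ boundaryIdeal X :=
  ⟨w, mem_moore_two_iff.2 h, hw, rfl⟩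

/- The witnesses in `X₃` below are the Peiffer pairings of Arvasi and Porter. -/

theorem degen_one_mul_mem_boundaryIdeal {x : X _⦋1⦌} (hx : face X (0 : Fin 2) x = 0)
    {z : X _⦋2⦌} (hz₁ : face X (1 : Fin 3) z = 0) (hz₂ : face X (2 : Fin 3) z = 0) :
    degen X (1 : Fin 2) x * z ∈ boundaryIdeal X := by
  have hw := mul_mem (degen_mem_degenerate 2 (degen X (1 : Fin 2) x))
    (add_mem (sub_mem (degen_mem_degenerate 2 z) (degen_mem_degenerate 1 z))
      (degen_mem_degenerate 0 z))
  simpa [hz₂] using face_three_mem_boundaryIdeal hw (by simp [hx, hz₁])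

theorem moore_mul_mem_boundaryIdeal {z w : X _⦋2⦌} (hz : z ∈ moore X 1)
    (hw : face X (2 : Fin 3) w = 0) : z * w ∈ boundaryIdeal X := by
  have hv := mul_mem (degen_mem_degenerate 2 z)
    (sub_mem (degen_mem_degenerate 2 w) (degen_mem_degenerate 1 w))
  simpa [hw] using face_three_mem_boundaryIdeal hv (by simp [mem_moore_one_iff.1 hz])

theorem peiffer_mul_mem_boundaryIdeal {z w : X _⦋2⦌} (hz : z ∈ moore X 1)
    (hw : face X (1 : Fin 3) w = 0) :
    (degen X (1 : Fin 2) (face X (2 : Fin 3) z) - z) * w ∈ boundaryIdeal X := by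
  have hv := mul_mem (sub_mem (degen_mem_degenerate 1 z) (degen_mem_degenerate 2 z))
    (degen_mem_degenerate 2 w)
  simpa using face_three_mem_boundaryIdeal hv (by simp [mem_moore_one_iff.1 hz, hw])

theorem degen_one_mul_sub_mem_boundaryIdeal {x : X _⦋1⦌} (hx : face X (0 : Fin 2) x = 0)
    {z : X _⦋2⦌} (hz : face X (1 : Fin 3) z = 0) :
    degen X (1 : Fin 2) x * (z - (degen X (1 : Fin 2) (face X (2 : Fin 3) z) -
      degen X (0 : Fin 2) (face X (2 : Fin 3) z))) ∈ boundaryIdeal X :=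
  degen_one_mul_mem_boundaryIdeal hx (by simp [hz]) (by simp [face_one_face_two, hz])

end BoundaryIdeal

namespace C2

variable {k : Type u} [CommRing k] {X : SimplicialObject (CommAlgCat.{v} k)}

theorem exists_mk_eq (c : C2 X) : ∃ (z : X _⦋2⦌) (hz : z ∈ moore X 1), mk X z hz = c := by
  obtain ⟨c, hc⟩ := c
  obtain ⟨z, hz, rfl⟩ := (Ideal.mem_map_iff_of_surjective _ Ideal.Quotient.mk_surjective).1 hc
  exact ⟨z, hz, rfl⟩

theorem mk_eq_mk {z w : X _⦋2⦌} {hz : z ∈ moore X 1} {hw : w ∈ moore X 1} :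
    mk X z hz = mk X w hw ↔ z - w ∈ boundaryIdeal X :=
  Subtype.ext_iff.trans Ideal.Quotient.eq

theorem mk_congr {z w : X _⦋2⦌} {hz : z ∈ moore X 1} {hw : w ∈ moore X 1} (h : z = w) :
    mk X z hz = mk X w hw := by
  subst h
  rfl

theorem mk_add {z w : X _⦋2⦌} (hz : z ∈ moore X 1) (hw : w ∈ moore X 1) :
    mk X z hz + mk X w hw = mk X (z + w) (add_mem hz hw) := rfl

theorem mk_mul {z w : X _⦋2⦌} (hz : z ∈ moore X 1) (hw : w ∈ moore X 1) :
    mk X z hz * mk X w hw = mk X (z * w) (Ideal.mul_mem_left _ _ hw) := rfl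

theorem smul_mk (a : X _⦋1⦌) {z : X _⦋2⦌} (hz : z ∈ moore X 1) :
    a • mk X z hz = mk X (degen X (1 : Fin 2) a * z) (Ideal.mul_mem_left _ _ hz) := rfl

theorem bd_mk {z : X _⦋2⦌} (hz : z ∈ moore X 1) : bd X (mk X z hz) = face X (2 : Fin 3) z := rfl

instance : IsScalarTower (X _⦋1⦌) (C2 X) (C2 X) where
  smul_assoc a c c' := by
    obtain ⟨z, hz, rfl⟩ := exists_mk_eq c
    obtain ⟨w, hw, rfl⟩ := exists_mk_eq c'
    rw [smul_mk, smul_eq_mul, smul_eq_mul, mk_mul, mk_mul, smul_mk]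
    exact mk_congr (mul_assoc _ _ _)

instance : SMulCommClass (X _⦋1⦌) (C2 X) (C2 X) where
  smul_comm a c c' := by
    obtain ⟨z, hz, rfl⟩ := exists_mk_eq c
    obtain ⟨w, hw, rfl⟩ := exists_mk_eq c'
    rw [smul_mk, smul_eq_mul, smul_eq_mul, mk_mul, mk_mul, smul_mk]
    exact mk_congr (mul_left_comm _ _ _)

section LiftAddHom

variable {Q : Type*} [AddCommGroup Q] (ψ : X _⦋2⦌ →+ Q)
  (hψ : (boundaryIdeal X).toAddSubgroup ≤ ψ.ker)

/-- The additive map on `NX₂ / ∂₃(NX₃ ∩ D₃)` induced by an additive map on `X₂` which kills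
`∂₃(NX₃ ∩ D₃)`. -/
def liftAddHom : C2 X →+ Q :=
  (QuotientAddGroup.lift (boundaryIdeal X).toAddSubgroup ψ hψ).comp
    (c2Ideal X).subtype.toAddMonoidHom

theorem liftAddHom_mk {z : X _⦋2⦌} (hz : z ∈ moore X 1) :
    liftAddHom ψ hψ (mk X z hz) = ψ z := rfl

end LiftAddHom

theorem isCrossedModule : IsCrossedModule (bd X) := by
  intro c c'
  obtain ⟨z, hz, rfl⟩ := exists_mk_eq c
  obtain ⟨w, hw, rfl⟩ := exists_mk_eq c'
  rw [bd_mk, smul_mk, mk_mul, mk_eq_mk, ← sub_mul]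
  exact peiffer_mul_mem_boundaryIdeal hz (mem_moore_one_iff.1 hw).2

theorem face_zero_bd (c : C2 X) : face X (0 : Fin 2) (bd X c) = 0 := by
  obtain ⟨z, hz, rfl⟩ := exists_mk_eq c
  rw [bd_mk, face_zero_face_two, (mem_moore_one_iff.1 hz).1, map_zero]

theorem face_one_bd (c : C2 X) : face X (1 : Fin 2) (bd X c) = 0 := by
  obtain ⟨z, hz, rfl⟩ := exists_mk_eq c
  rw [bd_mk, face_one_face_two, (mem_moore_one_iff.1 hz).2, map_zero]

theorem pairing_add_left (x x' : kerFace X 0) (y : kerFace X 1) :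
    pairing X (x + x') y = pairing X x y + pairing X x' y := by
  rw [pairing, pairing, pairing, mk_add]
  exact mk_congr (by rw [Submodule.coe_add, map_add, add_mul])

theorem pairing_smul_left (a : X _⦋1⦌) (x : kerFace X 0) (y : kerFace X 1) :
    pairing X (a • x) y = a • pairing X x y := by
  rw [pairing, pairing, smul_mk]
  exact mk_congr (by rw [SetLike.val_smul, smul_eq_mul, map_mul, mul_assoc])

theorem pairing_add_right (x : kerFace X 0) (y y' : kerFace X 1) :
    pairing X x (y + y') = pairing X x y + pairing X x y' := by
  rw [pairing, pairing, pairing, mk_add]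
  exact mk_congr (by rw [Submodule.coe_add, map_add, map_add, add_sub_add_comm, mul_add])

theorem pairing_smul_right (a : X _⦋1⦌) (x : kerFace X 0) (y : kerFace X 1) :
    pairing X x (a • y) = a • pairing X x y := by
  have hy : face X (1 : Fin 2) (y : X _⦋1⦌) = 0 := y.2
  rw [pairing, pairing, smul_mk, mk_eq_mk]
  convert degen_one_mul_mem_boundaryIdeal (x := (x : X _⦋1⦌)) x.2
    (z := (degen X (1 : Fin 2) a - degen X (0 : Fin 2) a) * degen X (0 : Fin 2) (y : X _⦋1⦌))
    (by simp) (by simp [hy]) using 1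
  rw [SetLike.val_smul, smul_eq_mul, map_mul, map_mul]
  ring

theorem pairing_mul_pairing (x x' : kerFace X 0) (y y' : kerFace X 1) :
    pairing X (x * x') (y * y') = pairing X x y * pairing X x' y' := by
  have hy : face X (1 : Fin 2) (y : X _⦋1⦌) = 0 := y.2
  have hy' : face X (1 : Fin 2) (y' : X _⦋1⦌) = 0 := y'.2
  rw [pairing, pairing, pairing, mk_mul, mk_eq_mk]
  convert degen_one_mul_mem_boundaryIdeal (x := ((x * x' : kerFace X 0) : X _⦋1⦌)) (x * x').2
    (z := (degen X (1 : Fin 2) (y : X _⦋1⦌) - degen X (0 : Fin 2) (y : X _⦋1⦌)) *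
        degen X (0 : Fin 2) (y' : X _⦋1⦌) + degen X (0 : Fin 2) (y : X _⦋1⦌) *
        (degen X (1 : Fin 2) (y' : X _⦋1⦌) - degen X (0 : Fin 2) (y' : X _⦋1⦌)))
    (by simp) (by simp [hy, hy']) using 1
  simp only [MulMemClass.coe_mul, map_mul]
  ring

theorem bd_pairing (x : kerFace X 0) (y : kerFace X 1) :
    bd X (pairing X x y) = (y : X _⦋1⦌) * x := by
  have hy : face X (1 : Fin 2) (y : X _⦋1⦌) = 0 := y.2
  simp [pairing, bd_mk, hy, mul_comm]

theorem pairing_bd_left (c : C2 X) (h : bd X c ∈ kerFace X 0) (y : kerFace X 1) :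
    pairing X ⟨bd X c, h⟩ y = (y : X _⦋1⦌) • c := by
  have hy : face X (1 : Fin 2) (y : X _⦋1⦌) = 0 := y.2
  obtain ⟨z, hz, rfl⟩ := exists_mk_eq c
  rw [pairing, smul_mk, mk_eq_mk]
  have hpeiffer := peiffer_mul_mem_boundaryIdeal hz
    (w := degen X (1 : Fin 2) (y : X _⦋1⦌) - degen X (0 : Fin 2) (y : X _⦋1⦌)) (by simp)
  have hmoore := moore_mul_mem_boundaryIdeal hz (w := degen X (0 : Fin 2) (y : X _⦋1⦌))
    (by simp [hy])
  convert sub_mem hpeiffer hmoore using 1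
  simp only [bd_mk]
  ring

theorem pairing_bd_right (c : C2 X) (h : bd X c ∈ kerFace X 1) (x : kerFace X 0) :
    pairing X x ⟨bd X c, h⟩ = (x : X _⦋1⦌) • c := by
  obtain ⟨z, hz, rfl⟩ := exists_mk_eq c
  rw [pairing, smul_mk, eq_comm, mk_eq_mk, ← mul_sub]
  exact degen_one_mul_sub_mem_boundaryIdeal x.2 (mem_moore_one_iff.1 hz).2

variable (X)

/-- The map `Ker d₁ ⊗ Ker d₀ → NX₂ / ∂₃(NX₃ ∩ D₃)` induced by the pairing. -/
def tensorHom : (kerFace X 1 ⊗[X _⦋1⦌] kerFace X 0) →ₙₐ[X _⦋1⦌] C2 X where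
  toFun := TensorProduct.lift (LinearMap.mk₂ (X _⦋1⦌) (fun y x => pairing X x y)
    (fun y y' x => pairing_add_right x y y') (fun a y x => pairing_smul_right a x y)
    (fun y x x' => pairing_add_left x x' y) (fun a y x => pairing_smul_left a x y))
  map_smul' a s := map_smul _ a s
  map_zero' := map_zero _
  map_add' s s' := map_add _ s s'
  map_mul' s s' := by
    induction s with
    | zero => rw [zero_mul, map_zero, zero_mul]
    | add a b ha hb => rw [add_mul, map_add, map_add, ha, hb, add_mul]
    | tmul y x =>
      induction s' with
      | zero => rw [mul_zero, map_zero, mul_zero]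
      | add a b ha hb => rw [mul_add, map_add, map_add, ha, hb, mul_add]
      | tmul y' x' =>
        rw [Algebra.TensorProduct.tmul_mul_tmul]
        exact pairing_mul_pairing x x' y y'

theorem tensorHom_tmul (y : kerFace X 1) (x : kerFace X 0) :
    tensorHom X (y ⊗ₜ x) = pairing X x y := rfl

theorem bd_tensorHom (s : kerFace X 1 ⊗[X _⦋1⦌] kerFace X 0) :
    bd X (tensorHom X s) = idealTensorBd (kerFace X 1) (kerFace X 0) s := by
  induction s with
  | zero => rw [map_zero, map_zero, map_zero]
  | add a b ha hb => rw [map_add, map_add, ha, hb, map_add]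
  | tmul y x => exact bd_pairing x y

end C2

section BoundaryProj

variable {k : Type u} [CommRing k] (X : SimplicialObject (CommAlgCat.{v} k))

/-- An additive map `X₃ → Ker d₁ ∩ Ker d₂ ⊆ X₂` which agrees with `d₃` on `NX₃`. Unlike `d₃`, it
keeps its values in `Ker d₁ ∩ Ker d₂` on the summands of an element of `NX₃`, which need not lie in
`NX₃` themselves. -/
def boundaryProj : X _⦋3⦌ →+ X _⦋2⦌ where
  toFun w := face X (3 : Fin 4) w - face X (2 : Fin 4) w + face X (1 : Fin 4) w -
    degen X (1 : Fin 2) (face X (2 : Fin 3) (face X (1 : Fin 4) w))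
  map_zero' := by simp
  map_add' w w' := by
    simp only [map_add]
    abel

theorem boundaryProj_apply (w : X _⦋3⦌) :
    boundaryProj X w = face X (3 : Fin 4) w - face X (2 : Fin 4) w + face X (1 : Fin 4) w -
      degen X (1 : Fin 2) (face X (2 : Fin 3) (face X (1 : Fin 4) w)) := rfl

theorem boundaryProj_of_mem_moore {w : X _⦋3⦌} (hw : w ∈ moore X 2) :
    boundaryProj X w = face X (3 : Fin 4) w := by
  simp [boundaryProj_apply, mem_moore_two_iff.1 hw]

theorem face_one_boundaryProj (w : X _⦋3⦌) : face X (1 : Fin 3) (boundaryProj X w) = 0 := by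
  simp [boundaryProj_apply, face_one_face_three, face_one_face_two]

theorem face_two_boundaryProj (w : X _⦋3⦌) : face X (2 : Fin 3) (boundaryProj X w) = 0 := by
  simp [boundaryProj_apply, face_two_face_three]

theorem boundaryProj_mul_degen_degen (w : X _⦋3⦌) (x : X _⦋1⦌) :
    boundaryProj X (w * degen X (2 : Fin 3) (degen X (1 : Fin 2) x)) =
      degen X (1 : Fin 2) x * boundaryProj X w := by
  simp only [boundaryProj_apply, map_mul, face_three_degen_two, face_two_degen_two,
    face_one_degen_two, face_one_degen_one, face_two_degen_one]
  ring

variable {X}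

theorem boundaryProj_mul_degen_one (w : X _⦋3⦌) (z : X _⦋2⦌) :
    boundaryProj X (w * degen X (1 : Fin 3) z) =
      (degen X (1 : Fin 2) (face X (2 : Fin 3) z) - z) * (face X (3 : Fin 4) w -
        degen X (1 : Fin 2) (face X (2 : Fin 3) (face X (1 : Fin 4) w))) +
      z * boundaryProj X w := by
  simp only [boundaryProj_apply, map_mul, face_three_degen_one, face_two_degen_one,
    face_one_degen_one]
  ring

theorem boundaryProj_mul_degen_two (w : X _⦋3⦌) {z : X _⦋2⦌} (hz : face X (1 : Fin 3) z = 0) :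
    boundaryProj X (w * degen X (2 : Fin 3) z) =
      z * (face X (3 : Fin 4) w - face X (2 : Fin 4) w) := by
  simp only [boundaryProj_apply, map_mul, face_three_degen_two, face_two_degen_two,
    face_one_degen_two, hz, map_zero]
  ring

end BoundaryProj

/-- The property that the algebra of 2-simplices of `X` is the coproduct over `X₀` of two copies of
`X₁`, embedded by `s₁` and `s₀`, with a polynomial algebra on elements `t` of `NX₂`. -/
structure IsFreeInDegreeTwo {k : Type u} [CommRing k] (X : SimplicialObject (CommAlgCat.{v} k))
    {T : Type v} (t : T → X _⦋2⦌) : Prop where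
  mem_moore : ∀ τ, t τ ∈ moore X 1
  existsUnique_hom : ∀ (S : Type v) [CommRing S] (α β : X _⦋1⦌ →+* S) (γ : T → S),
    (∀ r, α (degen X (0 : Fin 1) r) = β (degen X (0 : Fin 1) r)) →
      ∃! θ : X _⦋2⦌ →+* S, (∀ a, θ (degen X (1 : Fin 2) a) = α a) ∧
        (∀ a, θ (degen X (0 : Fin 2) a) = β a) ∧ ∀ τ, θ (t τ) = γ τ

namespace IsFreeInDegreeTwo

variable {k : Type u} [CommRing k] {X : SimplicialObject (CommAlgCat.{v} k)}
  {T : Type v} {t : T → X _⦋2⦌} (P : IsFreeInDegreeTwo X t)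

include P

theorem face_zero_gen (τ : T) : face X (0 : Fin 3) (t τ) = 0 :=
  (mem_moore_one_iff.1 (P.mem_moore τ)).1

theorem face_one_gen (τ : T) : face X (1 : Fin 3) (t τ) = 0 :=
  (mem_moore_one_iff.1 (P.mem_moore τ)).2

section Desc

variable {S : Type v} [CommRing S] (α β : X _⦋1⦌ →+* S) (γ : T → S)
  (h : ∀ r, α (degen X (0 : Fin 1) r) = β (degen X (0 : Fin 1) r))

/-- The ring homomorphism on `X₂` which extends `α` along `s₁`, `β` along `s₀` and `γ` along
`t`. -/
noncomputable def desc : X _⦋2⦌ →+* S := (P.existsUnique_hom S α β γ h).choose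

theorem desc_degen_one (a : X _⦋1⦌) : P.desc α β γ h (degen X (1 : Fin 2) a) = α a :=
  (P.existsUnique_hom S α β γ h).choose_spec.1.1 a

theorem desc_degen_zero (a : X _⦋1⦌) : P.desc α β γ h (degen X (0 : Fin 2) a) = β a :=
  (P.existsUnique_hom S α β γ h).choose_spec.1.2.1 a

theorem desc_gen (τ : T) : P.desc α β γ h (t τ) = γ τ :=
  (P.existsUnique_hom S α β γ h).choose_spec.1.2.2 τ

end Desc

section Ext

variable {S : Type v} [CommRing S]

theorem hom_ext {f g : X _⦋2⦌ →+* S}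
    (h₁ : ∀ a, f (degen X (1 : Fin 2) a) = g (degen X (1 : Fin 2) a))
    (h₀ : ∀ a, f (degen X (0 : Fin 2) a) = g (degen X (0 : Fin 2) a))
    (ht : ∀ τ, f (t τ) = g (t τ)) : f = g :=
  (P.existsUnique_hom S (g.comp (degen X (1 : Fin 2)).toRingHom)
    (g.comp (degen X (0 : Fin 2)).toRingHom) (fun τ => g (t τ))
    fun r => congrArg g (degen_one_degen_zero X r)).unique
    ⟨h₁, h₀, ht⟩ ⟨fun _ => rfl, fun _ => rfl, fun _ => rfl⟩

theorem hom_eq_on_degenerate {f g : X _⦋3⦌ →+* S}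
    (h₂₁ : ∀ a, f (degen X (2 : Fin 3) (degen X (1 : Fin 2) a)) =
      g (degen X (2 : Fin 3) (degen X (1 : Fin 2) a)))
    (h₀ : ∀ z, f (degen X (0 : Fin 3) z) = g (degen X (0 : Fin 3) z))
    (h₁ : ∀ τ, f (degen X (1 : Fin 3) (t τ)) = g (degen X (1 : Fin 3) (t τ)))
    (h₂ : ∀ τ, f (degen X (2 : Fin 3) (t τ)) = g (degen X (2 : Fin 3) (t τ)))
    {w : X _⦋3⦌} (hw : w ∈ degenerate X 2) : f w = g w := by
  have hdegen_one : f.comp (degen X (1 : Fin 3)).toRingHom =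
      g.comp (degen X (1 : Fin 3)).toRingHom :=
    P.hom_ext (fun a => by simpa [degen_two_degen_one] using h₂₁ a)
      (fun a => by simpa [degen_one_degen_zero] using h₀ (degen X (0 : Fin 2) a)) h₁
  have hdegen_two : f.comp (degen X (2 : Fin 3)).toRingHom =
      g.comp (degen X (2 : Fin 3)).toRingHom :=
    P.hom_ext h₂₁ (fun a => by simpa [degen_two_degen_zero] using h₀ (degen X (1 : Fin 2) a)) h₂
  induction hw using Algebra.adjoin_induction with
  | mem w hw =>
    obtain ⟨i, z, rfl⟩ := hw
    fin_cases i
    exacts [h₀ z, congrArg (· z) hdegen_one, congrArg (· z) hdegen_two]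
  | algebraMap c =>
    rw [← (degen X (0 : Fin 3)).commutes c]
    exact h₀ _
  | add w w' _ _ hw hw' => rw [map_add, map_add, hw, hw']
  | mul w w' _ _ hw hw' => rw [map_mul, map_mul, hw, hw']

end Ext

/- In both span lemmas below, `s₀ d₀` is the identity modulo the given elements. -/

theorem mem_span_of_face_zero {z : X _⦋2⦌} (hz : face X (0 : Fin 3) z = 0) :
    z ∈ Ideal.span (degen X (1 : Fin 2) '' kerFace X 0 ∪ Set.range t) := by
  set L := Ideal.span (degen X (1 : Fin 2) '' (kerFace X 0 : Set (X _⦋1⦌)) ∪ Set.range t)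
  have hmod : Ideal.Quotient.mk L = (Ideal.Quotient.mk L).comp
      ((degen X (0 : Fin 2)).comp (face X (0 : Fin 3))).toRingHom := by
    refine P.hom_ext (fun a => Ideal.Quotient.eq.2 ?_) (fun a => ?_)
      fun τ => Ideal.Quotient.eq.2 ?_
    · refine Ideal.subset_span (Or.inl ⟨a - degen X (0 : Fin 1) (face X (0 : Fin 2) a), ?_, ?_⟩)
      · simp [RingHom.mem_ker]
      · simp [degen_one_degen_zero]
    · simp
    · have hτ : t τ ∈ L := Ideal.subset_span (Or.inr ⟨τ, rfl⟩)
      simpa [P.face_zero_gen] using hτ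
  simpa [hz, Ideal.Quotient.eq_zero_iff_mem] using congrArg (· z) hmod

theorem mem_span_of_face_zero_of_mem_degenerate {w : X _⦋3⦌} (hw : w ∈ degenerate X 2)
    (hw₀ : face X (0 : Fin 4) w = 0) :
    w ∈ Ideal.span ((fun x => degen X (2 : Fin 3) (degen X (1 : Fin 2) x)) '' kerFace X 0 ∪
      (Set.range (fun τ => degen X (1 : Fin 3) (t τ)) ∪
        Set.range (fun τ => degen X (2 : Fin 3) (t τ)))) := by
  set L := Ideal.span ((fun x => degen X (2 : Fin 3) (degen X (1 : Fin 2) x)) ''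
    (kerFace X 0 : Set (X _⦋1⦌)) ∪ (Set.range (fun τ => degen X (1 : Fin 3) (t τ)) ∪
      Set.range (fun τ => degen X (2 : Fin 3) (t τ))))
  have hmod : Ideal.Quotient.mk L w =
      Ideal.Quotient.mk L (degen X (0 : Fin 3) (face X (0 : Fin 4) w)) := by
    refine P.hom_eq_on_degenerate (f := Ideal.Quotient.mk L) (g := (Ideal.Quotient.mk L).comp
      ((degen X (0 : Fin 3)).comp (face X (0 : Fin 4))).toRingHom)
      (fun a => Ideal.Quotient.eq.2 ?_) (fun z => ?_) (fun τ => Ideal.Quotient.eq.2 ?_)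
      (fun τ => Ideal.Quotient.eq.2 ?_) hw
    · refine Ideal.subset_span (Or.inl ⟨a - degen X (0 : Fin 1) (face X (0 : Fin 2) a), ?_, ?_⟩)
      · simp [RingHom.mem_ker]
      · simp [degen_one_degen_zero, degen_two_degen_zero]
    · simp
    · have hτ : degen X (1 : Fin 3) (t τ) ∈ L :=
        Ideal.subset_span (Or.inr (Or.inl (Set.mem_range_self τ)))
      simpa [P.face_zero_gen] using hτ
    · have hτ : degen X (2 : Fin 3) (t τ) ∈ L :=
        Ideal.subset_span (Or.inr (Or.inr (Set.mem_range_self τ)))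
      simpa [P.face_zero_gen] using hτ
  simpa [hw₀, Ideal.Quotient.eq_zero_iff_mem] using hmod

theorem moore_le (H : AddSubgroup (X _⦋2⦌)) (hb : (boundaryIdeal X).toAddSubgroup ≤ H)
    (hp : ∀ x ∈ kerFace X 0, ∀ y ∈ kerFace X 1,
      degen X (1 : Fin 2) x * (degen X (1 : Fin 2) y - degen X (0 : Fin 2) y) ∈ H)
    (ht : ∀ a τ, degen X (1 : Fin 2) a * t τ ∈ H) : (moore X 1).toAddSubgroup ≤ H := by
  intro z hz
  obtain ⟨hz₀, hz₁⟩ := mem_moore_one_iff.1 hz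
  suffices h : z - degen X (1 : Fin 2) (face X (1 : Fin 3) z) ∈ H by simpa [hz₁] using h
  have hspan := P.mem_span_of_face_zero hz₀
  clear hz hz₀ hz₁
  induction hspan using Submodule.closure_induction with
  | zero => simp
  | add z z' _ _ hz hz' => simpa [add_sub_add_comm] using add_mem hz hz'
  | smul_mem f z hz =>
    rcases hz with ⟨x, hx, rfl⟩ | ⟨τ, rfl⟩
    · set g := f - degen X (1 : Fin 2) (face X (1 : Fin 3) f)
      have hg : face X (1 : Fin 3) g = 0 := by simp [g]
      have hpairing := hp x hx (face X (2 : Fin 3) g)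
        (by simp [RingHom.mem_ker, face_one_face_two, hg])
      convert add_mem (hb (degen_one_mul_sub_mem_boundaryIdeal hx hg)) hpairing using 1
      simp only [g, smul_eq_mul, map_mul, map_sub, face_one_degen_one, face_two_degen_one]
      ring
    · convert add_mem (hb (moore_mul_mem_boundaryIdeal (P.mem_moore τ)
        (w := f - degen X (1 : Fin 2) (face X (2 : Fin 3) f)) (by simp)))
        (ht (face X (2 : Fin 3) f) τ) using 1
      simp only [smul_eq_mul, map_mul, P.face_one_gen, mul_zero, map_zero, sub_zero]
      ring

theorem boundaryIdeal_le (H : AddSubgroup (X _⦋2⦌))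
    (hx : ∀ x ∈ kerFace X 0, ∀ z, face X (1 : Fin 3) z = 0 → face X (2 : Fin 3) z = 0 →
      degen X (1 : Fin 2) x * z ∈ H)
    (ht₁ : ∀ τ z, face X (1 : Fin 3) z = 0 →
      (degen X (1 : Fin 2) (face X (2 : Fin 3) (t τ)) - t τ) * z ∈ H)
    (ht₂ : ∀ τ z, face X (2 : Fin 3) z = 0 → t τ * z ∈ H) :
    (boundaryIdeal X).toAddSubgroup ≤ H := by
  rintro _ ⟨w, hw, hwd, rfl⟩
  suffices h : boundaryProj X w ∈ H by rwa [boundaryProj_of_mem_moore X hw] at h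
  have hspan := P.mem_span_of_face_zero_of_mem_degenerate hwd (mem_moore_two_iff.1 hw).1
  clear hw hwd
  induction hspan using Submodule.closure_induction with
  | zero => simp
  | add w w' _ _ hw hw' => simpa using add_mem hw hw'
  | smul_mem f w hw =>
    rcases hw with ⟨x, hxmem, rfl⟩ | ⟨τ, rfl⟩ | ⟨τ, rfl⟩
    · rw [smul_eq_mul, boundaryProj_mul_degen_degen]
      exact hx x hxmem _ (face_one_boundaryProj X f) (face_two_boundaryProj X f)
    · rw [smul_eq_mul, boundaryProj_mul_degen_one]
      exact add_mem (ht₁ τ _ (by simp [face_one_face_three])) (ht₂ τ _ (face_two_boundaryProj X f))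
    · rw [smul_eq_mul, boundaryProj_mul_degen_two f (P.face_one_gen τ)]
      exact ht₂ τ _ (by simp [face_two_face_three])

end IsFreeInDegreeTwo

section KerTensor

variable {k : Type u} [CommRing k] (X : SimplicialObject (CommAlgCat.{v} k))

/-- `X₁` as an algebra over `X₀` through `s₀`. -/
abbrev degenAlgebra : Algebra (X _⦋0⦌) (X _⦋1⦌) := (degen X (0 : Fin 1)).toRingHom.toAlgebra

attribute [local instance] degenAlgebra

theorem face_degen_zero (i : Fin 2) (r : X _⦋0⦌) : face X i (degen X (0 : Fin 1) r) = r := by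
  fin_cases i
  exacts [face_zero_degen_zero X r, face_one_degen_zero X r]

/-- The idempotent `s₀ dᵢ` of `X₁`. -/
def degenFace (i : Fin 2) : X _⦋1⦌ →ₐ[X _⦋0⦌] X _⦋1⦌ where
  __ := ((degen X (0 : Fin 1)).comp (face X i)).toRingHom
  commutes' r := congrArg (degen X (0 : Fin 1)) (face_degen_zero X i r)

theorem degenFace_apply (i : Fin 2) (a : X _⦋1⦌) :
    degenFace X i a = degen X (0 : Fin 1) (face X i a) := rfl

/-- The projection `a ↦ a - s₀ dᵢ a` of `X₁` onto `Ker dᵢ`. -/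
def kerProj (i : Fin 2) : X _⦋1⦌ →ₗ[X _⦋0⦌] kerFace X i :=
  (LinearMap.id - (degenFace X i).toLinearMap).codRestrict
    ((kerFace X i).restrictScalars (X _⦋0⦌))
    fun a => by simp [RingHom.mem_ker, degenFace_apply, face_degen_zero]

theorem coe_kerProj (i : Fin 2) (a : X _⦋1⦌) :
    (kerProj X i a : X _⦋1⦌) = a - degen X (0 : Fin 1) (face X i a) := rfl

/-- The additive map `X₁ ⊗ X₁ → Ker d₁ ⊗ Ker d₀`, `a ⊗ b ↦ (b - s₀ d₁ b) ⊗ (a - s₀ d₀ a)`, from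
the tensor product over `X₀` to the one over `X₁`. -/
noncomputable def kerTensor :
    X _⦋1⦌ ⊗[X _⦋0⦌] X _⦋1⦌ →ₗ[X _⦋0⦌] kerFace X 1 ⊗[X _⦋1⦌] kerFace X 0 :=
  (TensorProduct.mapOfCompatibleSMul (X _⦋1⦌) (X _⦋0⦌) (X _⦋0⦌) (kerFace X 1) (kerFace X 0)) ∘ₗ
    (TensorProduct.map (kerProj X 1) (kerProj X 0)) ∘ₗ
      (TensorProduct.comm (X _⦋0⦌) (X _⦋1⦌) (X _⦋1⦌)).toLinearMap

/-- The `X₁`-linear map `X₁ ⊗ X₁ → Ker d₁`, `a ⊗ b ↦ a (b - s₀ d₁ b)`. -/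
noncomputable def kerMul : X _⦋1⦌ ⊗[X _⦋0⦌] X _⦋1⦌ →ₗ[X _⦋1⦌] kerFace X 1 :=
  (kerProj X 1).liftBaseChange (X _⦋1⦌)

variable {X}

theorem kerTensor_tmul_one_mul (x : kerFace X 0) (s : X _⦋1⦌ ⊗[X _⦋0⦌] X _⦋1⦌) :
    kerTensor X ((x : X _⦋1⦌) ⊗ₜ 1 * s) = kerMul X s ⊗ₜ x := by
  induction s with
  | zero => rw [mul_zero, map_zero, map_zero, TensorProduct.zero_tmul]
  | add s s' hs hs' => rw [mul_add, map_add, map_add, hs, hs', TensorProduct.add_tmul]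
  | tmul a b =>
    have hx : face X (0 : Fin 2) (x : X _⦋1⦌) = 0 := x.2
    have hproj : kerProj X 0 (x * a) = a • x := by
      refine Subtype.ext ?_
      simp [coe_kerProj, hx, mul_comm]
    rw [Algebra.TensorProduct.tmul_mul_tmul, one_mul]
    change kerProj X 1 b ⊗ₜ kerProj X 0 (x * a) = (a • kerProj X 1 b) ⊗ₜ x
    rw [hproj, TensorProduct.smul_tmul]

theorem coe_kerMul (s : X _⦋1⦌ ⊗[X _⦋0⦌] X _⦋1⦌) :
    (kerMul X s : X _⦋1⦌) = Algebra.TensorProduct.lmul' (X _⦋0⦌) s -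
      Algebra.TensorProduct.productMap (AlgHom.id (X _⦋0⦌) (X _⦋1⦌)) (degenFace X 1) s := by
  induction s with
  | zero => simp
  | add s s' hs hs' => simp only [map_add, Submodule.coe_add, hs, hs', add_sub_add_comm]
  | tmul a b => exact mul_sub _ _ _

end KerTensor

namespace IsFreeInDegreeTwo

variable {k : Type u} [CommRing k] {X : SimplicialObject (CommAlgCat.{v} k)}
  {T : Type v} {t : T → X _⦋2⦌} (P : IsFreeInDegreeTwo X t)

attribute [local instance] degenAlgebra

/-- The ring homomorphism `X₂ → X₁ ⊗ X₁` which maps `s₁ a * s₀ b` to `a ⊗ b` and kills `t`. -/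
noncomputable def toTensor : X _⦋2⦌ →+* X _⦋1⦌ ⊗[X _⦋0⦌] X _⦋1⦌ :=
  P.desc (Algebra.TensorProduct.includeLeft (R := X _⦋0⦌) (S := X _⦋0⦌)).toRingHom
    (Algebra.TensorProduct.includeRight (R := X _⦋0⦌)).toRingHom 0 fun r =>
      (AlgHom.commutes Algebra.TensorProduct.includeLeft r).trans
        (AlgHom.commutes Algebra.TensorProduct.includeRight r).symm

theorem toTensor_degen_one (a : X _⦋1⦌) : P.toTensor (degen X (1 : Fin 2) a) = a ⊗ₜ 1 :=
  P.desc_degen_one ..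

theorem toTensor_degen_zero (a : X _⦋1⦌) : P.toTensor (degen X (0 : Fin 2) a) = 1 ⊗ₜ a :=
  P.desc_degen_zero ..

theorem toTensor_gen (τ : T) : P.toTensor (t τ) = 0 :=
  P.desc_gen ..

variable {C : Type v} [NonUnitalCommRing C] [Module (X _⦋1⦌) C] [IsScalarTower (X _⦋1⦌) C C]
  [SMulCommClass (X _⦋1⦌) C C] (ι : T → C)

/-- The ring homomorphism from `X₂` to `X₁ × C`, the algebra `C` with a unit adjoined, which is
`(a, 0)` on `s₁ a`, `(s₀ d₁ a, 0)` on `s₀ a` and `(0, ι τ)` on `t τ`. -/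
noncomputable def toUnitization : X _⦋2⦌ →+* Unitization (X _⦋1⦌) C :=
  P.desc (Unitization.inlRingHom (X _⦋1⦌) C)
    ((Unitization.inlRingHom (X _⦋1⦌) C).comp (degenFace X 1).toRingHom)
    (fun τ => Unitization.inr (ι τ))
    fun r => congrArg (Unitization.inlRingHom (X _⦋1⦌) C) ((degenFace X 1).commutes r).symm

theorem toUnitization_degen_one (a : X _⦋1⦌) :
    P.toUnitization ι (degen X (1 : Fin 2) a) = Unitization.inl a :=
  P.desc_degen_one ..

theorem toUnitization_degen_zero (a : X _⦋1⦌) :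
    P.toUnitization ι (degen X (0 : Fin 2) a) =
      Unitization.inl (degen X (0 : Fin 1) (face X (1 : Fin 2) a)) :=
  P.desc_degen_zero ..

theorem toUnitization_gen (τ : T) : P.toUnitization ι (t τ) = Unitization.inr (ι τ) :=
  P.desc_gen ..

theorem coe_kerMul_toTensor (z : X _⦋2⦌) :
    (kerMul X (P.toTensor z) : X _⦋1⦌) =
      face X (1 : Fin 3) z - (P.toUnitization ι z).fst := by
  have hmul : (Algebra.TensorProduct.lmul' (X _⦋0⦌)).toRingHom.comp P.toTensor =
      (face X (1 : Fin 3)).toRingHom :=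
    P.hom_ext (fun a => by simp [toTensor_degen_one]) (fun a => by simp [toTensor_degen_zero])
      fun τ => by simp [toTensor_gen, P.face_one_gen]
  have hproj : (Algebra.TensorProduct.productMap (AlgHom.id (X _⦋0⦌) (X _⦋1⦌))
      (degenFace X 1)).toRingHom.comp P.toTensor =
      (Unitization.fstHom (X _⦋1⦌) C).toRingHom.comp (P.toUnitization ι) :=
    P.hom_ext (fun a => by simp [toTensor_degen_one, toUnitization_degen_one])
      (fun a => by simp [toTensor_degen_zero, toUnitization_degen_zero, degenFace_apply])
      fun τ => by simp [toTensor_gen, toUnitization_gen]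
  rw [coe_kerMul]
  exact congrArg₂ (· - ·) (congrArg (· z) hmul) (congrArg (· z) hproj)

variable {ι} {bdC : C →ₙₐ[X _⦋1⦌] X _⦋1⦌}

theorem face_two_eq_fst_add_bd_snd (hι : ∀ τ, bdC (ι τ) = face X (2 : Fin 3) (t τ))
    (z : X _⦋2⦌) :
    face X (2 : Fin 3) z = (P.toUnitization ι z).fst + bdC (P.toUnitization ι z).snd := by
  have h : (face X (2 : Fin 3)).toRingHom =
      (Unitization.lift bdC).toRingHom.comp (P.toUnitization ι) :=
    P.hom_ext (fun a => by simp [toUnitization_degen_one])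
      (fun a => by simp [toUnitization_degen_zero])
      fun τ => by simp [toUnitization_gen, hι]
  exact congrArg (· z) h

theorem snd_toUnitization_degen_one_mul (a : X _⦋1⦌) (z : X _⦋2⦌) :
    (P.toUnitization ι (degen X (1 : Fin 2) a * z)).snd = a • (P.toUnitization ι z).snd := by
  rw [map_mul, toUnitization_degen_one, Unitization.snd_mul]
  simp

theorem snd_toUnitization_gen_mul (hC : IsCrossedModule bdC)
    (hι : ∀ τ, bdC (ι τ) = face X (2 : Fin 3) (t τ)) (τ : T) (z : X _⦋2⦌) :
    (P.toUnitization ι (t τ * z)).snd = face X (2 : Fin 3) z • ι τ := by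
  rw [map_mul, toUnitization_gen, P.face_two_eq_fst_add_bd_snd hι z, add_smul, hC, mul_comm,
    Unitization.snd_mul]
  simp

end IsFreeInDegreeTwo

namespace IsFreeInDegreeTwo

variable {k : Type u} [CommRing k] {X : SimplicialObject (CommAlgCat.{v} k)}
  {T : Type v} {t : T → X _⦋2⦌} (P : IsFreeInDegreeTwo X t)

section Retraction

variable {C : Type v} [NonUnitalCommRing C] [Module (X _⦋1⦌) C] [IsScalarTower (X _⦋1⦌) C C]
  [SMulCommClass (X _⦋1⦌) C C] {Q : Type*} [AddCommGroup Q] (ι : T → C)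
  (i : kerFace X 1 ⊗[X _⦋1⦌] kerFace X 0 →+ Q) (j : C →+ Q)

attribute [local instance] degenAlgebra

/-- The additive map on `X₂` which is `i (y ⊗ x)` on `s₁ x * (s₁ y - s₀ y)` and `j (a • ι τ)` on
`s₁ a * t τ`. -/
noncomputable def retraction : X _⦋2⦌ →+ Q :=
  j.comp ((Unitization.sndHom (X _⦋1⦌) (X _⦋1⦌) C).toAddMonoidHom.comp
      (P.toUnitization ι).toAddMonoidHom) -
    i.comp ((kerTensor X).toAddMonoidHom.comp P.toTensor.toAddMonoidHom)

theorem retraction_apply (z : X _⦋2⦌) :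
    P.retraction ι i j z = j (P.toUnitization ι z).snd - i (kerTensor X (P.toTensor z)) := rfl

theorem retraction_degen_one_mul (x : kerFace X 0) (z : X _⦋2⦌) :
    P.retraction ι i j (degen X (1 : Fin 2) (x : X _⦋1⦌) * z) =
      j ((x : X _⦋1⦌) • (P.toUnitization ι z).snd) - i (kerMul X (P.toTensor z) ⊗ₜ x) := by
  rw [retraction_apply, snd_toUnitization_degen_one_mul, map_mul, toTensor_degen_one,
    kerTensor_tmul_one_mul]

theorem retraction_pairing (x : kerFace X 0) (y : kerFace X 1) :
    P.retraction ι i j (degen X (1 : Fin 2) (x : X _⦋1⦌) *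
      (degen X (1 : Fin 2) (y : X _⦋1⦌) - degen X (0 : Fin 2) (y : X _⦋1⦌))) = i (y ⊗ₜ x) := by
  have hy : face X (1 : Fin 2) (y : X _⦋1⦌) = 0 := y.2
  set z := degen X (1 : Fin 2) (y : X _⦋1⦌) - degen X (0 : Fin 2) (y : X _⦋1⦌)
  have hz : P.toUnitization ι z = Unitization.inl (y : X _⦋1⦌) := by
    simp [z, toUnitization_degen_one, toUnitization_degen_zero, hy]
  have hmul : kerMul X (P.toTensor z) = -y := by
    refine Subtype.ext ?_
    rw [P.coe_kerMul_toTensor ι, hz]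
    simp [z]
  rw [retraction_degen_one_mul, hmul, hz, TensorProduct.neg_tmul, map_neg, sub_neg_eq_add]
  simp

variable {ι} {bdC : C →ₙₐ[X _⦋1⦌] X _⦋1⦌} (hC : IsCrossedModule bdC)
  (hι : ∀ τ, bdC (ι τ) = face X (2 : Fin 3) (t τ))

include hC hι

theorem retraction_gen_mul (τ : T) (z : X _⦋2⦌) :
    P.retraction ι i j (t τ * z) = j (face X (2 : Fin 3) z • ι τ) := by
  rw [retraction_apply, P.snd_toUnitization_gen_mul hC hι, map_mul, toTensor_gen, zero_mul,
    map_zero, map_zero, sub_zero]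

variable {i j} (hJ : ∀ c, bdC c ∈ kerFace X 1) (hI : ∀ c, bdC c ∈ kerFace X 0)
  (hn : ∀ (c : C) (n : kerFace X 1), i (n ⊗ₜ ⟨bdC c, hI c⟩) = j ((n : X _⦋1⦌) • c))
  (hm : ∀ (c : C) (m : kerFace X 0), i (⟨bdC c, hJ c⟩ ⊗ₜ m) = j ((m : X _⦋1⦌) • c))

include hn hm

theorem boundaryIdeal_le_ker_retraction :
    (boundaryIdeal X).toAddSubgroup ≤ (P.retraction ι i j).ker := by
  have hd₂ := P.face_two_eq_fst_add_bd_snd hι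
  refine P.boundaryIdeal_le _ (fun x hx z hz₁ hz₂ => ?_) (fun τ z hz₁ => ?_) fun τ z hz₂ => ?_
  · have hmul : kerMul X (P.toTensor z) = ⟨bdC (P.toUnitization ι z).snd, hJ _⟩ := by
      refine Subtype.ext ?_
      rw [P.coe_kerMul_toTensor ι, hz₁, zero_sub]
      exact neg_eq_of_add_eq_zero_right ((hd₂ z).symm.trans hz₂)
    rw [AddMonoidHom.mem_ker, P.retraction_degen_one_mul ι i j ⟨x, hx⟩ z, hmul, hm, sub_self]
  · have hmul : (kerMul X (P.toTensor z) : X _⦋1⦌) = -(P.toUnitization ι z).fst := by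
      rw [P.coe_kerMul_toTensor ι, hz₁, zero_sub]
    rw [AddMonoidHom.mem_ker, sub_mul, map_sub, P.retraction_gen_mul i j hC hι, ← hι,
      P.retraction_degen_one_mul ι i j ⟨bdC (ι τ), hI _⟩ z, hn, hmul, hC, mul_comm, ← hC, hd₂,
      ← map_sub, ← map_sub, ← sub_smul, ← sub_smul, sub_neg_eq_add, add_comm, sub_self,
      zero_smul, map_zero]
  · rw [AddMonoidHom.mem_ker, P.retraction_gen_mul i j hC hι, hz₂, zero_smul, map_zero]

end Retraction

end IsFreeInDegreeTwo

section CrossedModuleLifts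

variable {A : Type v} [CommRing A]

theorem subset_actSpan {P : Type v} [NonUnitalCommRing P] [Module A P] {s : Set P} :
    s ⊆ (actSpan A s).toSubmodule :=
  fun _ hx => Submodule.mem_sInf.2 fun _ hN => hN.1 hx

namespace IsFreeCrossedModule

variable {T : Type v} {f : T → A} {C : Type v} [NonUnitalCommRing C] [Module A C]
  [IsScalarTower A C C] [SMulCommClass A C C] {bd : C →ₙₐ[A] A} {ι : T → C}

/- By the crossed module identity the span of the generators is a subalgebra, so the universal
property provides a retraction of `C` onto it. -/
theorem mem_span (h : IsFreeCrossedModule f bd ι) (c : C) :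
    c ∈ Submodule.span A (Set.range ι) := by
  obtain ⟨hbd, hι, huniv⟩ := h
  let S : NonUnitalSubalgebra A C :=
    { Submodule.span A (Set.range ι) with
      mul_mem' := fun {c d} _ hd => hbd c d ▸ Submodule.smul_mem _ _ hd }
  let incl : S →ₙₐ[A] C := NonUnitalSubalgebraClass.subtype S
  obtain ⟨φ, ⟨hφ, hφι⟩, -⟩ := huniv S (bd.comp incl)
    (fun t => ⟨ι t, Submodule.subset_span ⟨t, rfl⟩⟩) (fun c d => Subtype.ext (hbd c d)) hι
  have hretract : incl.comp φ = NonUnitalAlgHom.id A C :=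
    (huniv C bd ι hbd hι).unique ⟨hφ, fun t => congrArg Subtype.val (hφι t)⟩
      ⟨fun _ => rfl, fun _ => rfl⟩
  have hc : (φ c : C) = c := congrArg (· c) hretract
  exact hc ▸ (φ c).2

end IsFreeCrossedModule

variable {Q : Type v} [NonUnitalCommRing Q] [Module A Q] {bdQ : Q →ₙₐ[A] A}

section Coprod

variable {M N : Type v} [NonUnitalCommRing M] [Module A M] [NonUnitalCommRing N] [Module A N]
  [IsScalarTower A N N] [SMulCommClass A N N] {bd₁ : M →ₙₐ[A] A} {bd₂ : N →ₙₐ[A] A}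

section Lift

variable (hQ : IsCrossedModule bdQ) (f : M →ₙₐ[A] Q) (g : N →ₙₐ[A] Q)
  (hf : ∀ m, bdQ (f m) = bd₁ m) (hg : ∀ n, bdQ (g n) = bd₂ n)

/-- The map `M ⋊ N → Q` given by two maps into a crossed module. -/
def Semi.lift : Semi bd₁ N →ₙₐ[A] Q where
  toFun p := f p.fst + g p.snd
  map_smul' a p := by
    change f (a • p.fst) + g (a • p.snd) = a • (f p.fst + g p.snd)
    rw [map_smul, map_smul, smul_add]
  map_zero' := by
    change f 0 + g 0 = 0
    rw [map_zero, map_zero, add_zero]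
  map_add' p q := by
    change f (p.fst + q.fst) + g (p.snd + q.snd) = _
    rw [map_add, map_add, add_add_add_comm]
  map_mul' p q := by
    change f (p.fst * q.fst) + g (bd₁ q.fst • p.snd + bd₁ p.fst • q.snd + p.snd * q.snd) = _
    simp only [map_mul, map_add, map_smul, ← hf, mul_add, add_mul]
    rw [hQ, hQ, mul_comm (f q.fst)]
    abel

include hg in
theorem Semi.bd_lift (p : Semi bd₁ N) : bdQ (Semi.lift hQ f g hf p) = Semi.bd bd₁ bd₂ p := by
  change bdQ (f p.fst + g p.snd) = bd₁ p.fst + bd₂ p.snd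
  rw [map_add, hf, hg]

/-- The map `M ⊔ N → Q` given by two maps of crossed modules. -/
def Coprod.lift : Coprod bd₁ bd₂ →ₙₐ[A] Q :=
  (coprodPeiffer bd₁ bd₂).lift (Semi.lift hQ f g hf) (actSpan_le_ker _ (by
    rintro _ ⟨p, q, rfl⟩
    rw [map_sub, map_mul, map_smul, ← Semi.bd_lift hQ f g hf hg, hQ, sub_self]))

theorem Coprod.lift_inl (m : M) :
    Coprod.lift hQ f g hf hg (Coprod.inl bd₁ bd₂ m) = f m := by
  change f m + g 0 = f m
  rw [map_zero, add_zero]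

theorem Coprod.lift_inr (n : N) :
    Coprod.lift hQ f g hf hg (Coprod.inr bd₁ bd₂ n) = g n := by
  change f 0 + g n = g n
  rw [map_zero, zero_add]

end Lift

namespace Coprod

variable (bd₁ bd₂)

theorem inl_add (m m' : M) : inl bd₁ bd₂ (m + m') = inl bd₁ bd₂ m + inl bd₁ bd₂ m' :=
  congrArg (coprodPeiffer bd₁ bd₂).proj (Semi.ext rfl (add_zero (0 : N)).symm)

theorem inr_add (n n' : N) : inr bd₁ bd₂ (n + n') = inr bd₁ bd₂ n + inr bd₁ bd₂ n' :=
  congrArg (coprodPeiffer bd₁ bd₂).proj (Semi.ext (add_zero (0 : M)).symm rfl)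

theorem exists_inl_add_inr (z : Coprod bd₁ bd₂) : ∃ m n, inl bd₁ bd₂ m + inr bd₁ bd₂ n = z := by
  obtain ⟨⟨m, n⟩, rfl⟩ := (coprodPeiffer bd₁ bd₂).proj_surj z
  exact ⟨m, n, congrArg (coprodPeiffer bd₁ bd₂).proj (Semi.ext (add_zero m) (zero_add n))⟩

end Coprod

end Coprod

namespace Adjoin

variable {J I : Ideal A} {C : Type v} [NonUnitalCommRing C] [Module A C] [IsScalarTower A C C]
  [SMulCommClass A C C] {bdC : C →ₙₐ[A] A} (hJ : ∀ c, bdC c ∈ J) (hI : ∀ c, bdC c ∈ I)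

/-- `Adjoin.inl` as an additive map. -/
def inlAddHom : J ⊗[A] I →+ Adjoin J I bdC hJ hI where
  toFun := inl J I bdC hJ hI
  map_zero' := rfl
  map_add' s s' := congrArg (adjoinRel J I bdC hJ hI).proj (Coprod.inl_add _ _ s s')

/-- `Adjoin.inr` as an additive map. -/
def inrAddHom : C →+ Adjoin J I bdC hJ hI where
  toFun := inr J I bdC hJ hI
  map_zero' := rfl
  map_add' c c' := congrArg (adjoinRel J I bdC hJ hI).proj (Coprod.inr_add _ _ c c')

theorem exists_inl_add_inr (z : Adjoin J I bdC hJ hI) :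
    ∃ s c, inl J I bdC hJ hI s + inr J I bdC hJ hI c = z := by
  obtain ⟨w, rfl⟩ := (adjoinRel J I bdC hJ hI).proj_surj z
  obtain ⟨s, c, rfl⟩ := Coprod.exists_inl_add_inr _ _ w
  exact ⟨s, c, rfl⟩

theorem inl_tmul_bd (c : C) (n : J) :
    inl J I bdC hJ hI (n ⊗ₜ ⟨bdC c, hI c⟩) = inr J I bdC hJ hI ((n : A) • c) :=
  (adjoinRel J I bdC hJ hI).proj_eq.2 (subset_actSpan (Or.inl ⟨c, n, rfl⟩))

theorem inl_bd_tmul (c : C) (m : I) :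
    inl J I bdC hJ hI (⟨bdC c, hJ c⟩ ⊗ₜ m) = inr J I bdC hJ hI ((m : A) • c) :=
  (adjoinRel J I bdC hJ hI).proj_eq.2 (subset_actSpan (Or.inr ⟨c, m, rfl⟩))

theorem bd_inl (s : J ⊗[A] I) :
    Adjoin.bd J I bdC hJ hI (inl J I bdC hJ hI s) = idealTensorBd J I s := by
  change idealTensorBd J I s + bdC 0 = _
  rw [map_zero, add_zero]

theorem bd_inr (c : C) : Adjoin.bd J I bdC hJ hI (inr J I bdC hJ hI c) = bdC c := by
  change idealTensorBd J I 0 + bdC c = _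
  rw [map_zero, zero_add]

section Lift

variable {hJ hI} (hQ : IsCrossedModule bdQ) (f : J ⊗[A] I →ₙₐ[A] Q) (g : C →ₙₐ[A] Q)
  (hf : ∀ s, bdQ (f s) = idealTensorBd J I s) (hg : ∀ c, bdQ (g c) = bdC c)
  (hn : ∀ (c : C) (n : J), f (n ⊗ₜ ⟨bdC c, hI c⟩) = g ((n : A) • c))
  (hm : ∀ (c : C) (m : I), f (⟨bdC c, hJ c⟩ ⊗ₜ m) = g ((m : A) • c))

/-- The map `((J ⊗ I) ⊔ C) / ∼ → Q` given by two maps of crossed modules which respect the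
relations. -/
def lift : Adjoin J I bdC hJ hI →ₙₐ[A] Q :=
  (adjoinRel J I bdC hJ hI).lift (Coprod.lift hQ f g hf hg) (actSpan_le_ker _ (by
    rintro _ (⟨c, n, rfl⟩ | ⟨c, m, rfl⟩)
    · rw [map_sub, Coprod.lift_inl, Coprod.lift_inr, hn, sub_self]
    · rw [map_sub, Coprod.lift_inl, Coprod.lift_inr, hm, sub_self]))

theorem lift_inl (s : J ⊗[A] I) :
    lift hQ f g hf hg hn hm (inl J I bdC hJ hI s) = f s :=
  Coprod.lift_inl hQ f g hf hg s

theorem lift_inr (c : C) : lift hQ f g hf hg hn hm (inr J I bdC hJ hI c) = g c :=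
  Coprod.lift_inr hQ f g hf hg c

theorem bd_lift (z : Adjoin J I bdC hJ hI) :
    bdQ (lift hQ f g hf hg hn hm z) = Adjoin.bd J I bdC hJ hI z := by
  obtain ⟨s, c, rfl⟩ := exists_inl_add_inr hJ hI z
  rw [map_add, map_add, map_add, lift_inl, lift_inr, hf, hg, bd_inl, bd_inr]

end Lift

end Adjoin

end CrossedModuleLifts

section Simplices

theorem exists_eq_σ_comp_of_le {n i : ℕ} (h : i ≤ n) (s : ⦋n + 1⦌ ⟶ ⦋i⦌) :
    ∃ (a : Fin (n + 1)) (s' : ⦋n⦌ ⟶ ⦋i⦌), s = SimplexCategory.σ a ≫ s' := by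
  refine SimplexCategory.eq_σ_comp_of_not_injective s fun hs => ?_
  have hcard := Fintype.card_le_of_injective _ hs
  simp only [SimplexCategory.len_mk, Fintype.card_fin] at hcard
  lia

theorem σ_zero_ne_σ_one : SimplexCategory.σ (0 : Fin 2) ≠ SimplexCategory.σ (1 : Fin 2) := by
  intro h
  have h₁ := congrArg (fun f => SimplexCategory.Hom.toOrderHom f (1 : Fin 3)) h
  revert h₁
  decide

variable {k : Type u} [CommRing k] (X : SimplicialObject (CommAlgCat.{v} k))

theorem map_id_op_apply {n : ℕ} (y : X _⦋n⦌) : (X.map (𝟙 ⦋n⦌ : ⦋n⦌ ⟶ ⦋n⦌).op).hom y = y := by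
  rw [op_id, X.map_id]
  rfl

theorem map_comp_op_apply {a b c : SimplexCategory} (f : a ⟶ b) (g : b ⟶ c)
    (y : X.obj (op c)) : (X.map (f ≫ g).op).hom y = (X.map f.op).hom ((X.map g.op).hom y) := by
  rw [op_comp, X.map_comp]
  rfl

theorem map_const_one (r : X _⦋0⦌) :
    (X.map (SimplexCategory.const ⦋1⦌ ⦋0⦌ 0).op).hom r = degen X (0 : Fin 1) r := by
  rw [Subsingleton.elim (SimplexCategory.const ⦋1⦌ ⦋0⦌ 0) (SimplexCategory.σ (0 : Fin 1))]
  rfl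

theorem map_const_two (r : X _⦋0⦌) : (X.map (SimplexCategory.const ⦋2⦌ ⦋0⦌ 0).op).hom r =
    degen X (0 : Fin 2) (degen X (0 : Fin 1) r) := by
  rw [Subsingleton.elim (SimplexCategory.const ⦋2⦌ ⦋0⦌ 0)
    (SimplexCategory.σ (0 : Fin 2) ≫ SimplexCategory.σ (0 : Fin 1)), map_comp_op_apply]
  rfl

end Simplices

namespace FreeData

variable {k : Type u} [CommRing k] {E : SimplicialObject (CommAlgCat.{v} k)} (F : FreeData E)

/-- The index set of the polynomial generators of `Eₙ`: a generator of `E` together with an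
iterated degeneracy into dimension `n`. -/
abbrev Index (n : ℕ) : Type v := Σ m : ℕ, {s : ⦋n⦌ ⟶ ⦋m + 1⦌ // Epi s} × F.gen m

theorem index_one_cases {p : F.Index 1 → Prop}
    (h : ∀ (x : F.gen 0) (he : Epi (𝟙 ⦋1⦌)), p ⟨0, ⟨𝟙 ⦋1⦌, he⟩, x⟩) (a : F.Index 1) : p a := by
  obtain ⟨m, ⟨s, hs⟩, x⟩ := a
  obtain rfl : m = 0 := by simpa using SimplexCategory.len_le_of_epi s
  obtain rfl := SimplexCategory.eq_id_of_epi s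
  exact h x hs

theorem index_two_cases {p : F.Index 2 → Prop}
    (h₀ : ∀ (x : F.gen 0) (he : Epi (SimplexCategory.σ (0 : Fin 2))),
      p ⟨0, ⟨SimplexCategory.σ (0 : Fin 2), he⟩, x⟩)
    (h₁ : ∀ (x : F.gen 0) (he : Epi (SimplexCategory.σ (1 : Fin 2))),
      p ⟨0, ⟨SimplexCategory.σ (1 : Fin 2), he⟩, x⟩)
    (ht : ∀ (x : F.gen 1) (he : Epi (𝟙 ⦋2⦌)), p ⟨1, ⟨𝟙 ⦋2⦌, he⟩, x⟩) (a : F.Index 2) : p a := by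
  obtain ⟨m, ⟨s, hs⟩, x⟩ := a
  have hm : m + 1 ≤ 2 := SimplexCategory.len_le_of_epi s
  obtain rfl | rfl : m = 0 ∨ m = 1 := by lia
  · obtain ⟨i, rfl⟩ := SimplexCategory.eq_σ_of_epi s
    fin_cases i
    exacts [h₀ x hs, h₁ x hs]
  · obtain rfl := SimplexCategory.eq_id_of_epi s
    exact ht x hs

theorem existsUnique_hom (n : ℕ) {S : Type*} [CommRing S] (f : E _⦋0⦌ →+* S)
    (val : F.Index n → S) :
    ∃! θ : E _⦋n⦌ →+* S, (∀ r, θ ((E.map (SimplexCategory.const ⦋n⦌ ⦋0⦌ 0).op).hom r) = f r) ∧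
      ∀ a : F.Index n, θ ((E.map a.2.1.1.op).hom (F.ι a.2.2)) = val a := by
  set e := RingEquiv.ofBijective _ (F.free n)
  have he_C : ∀ r, e (MvPolynomial.C r) = (E.map (SimplexCategory.const ⦋n⦌ ⦋0⦌ 0).op).hom r :=
    MvPolynomial.eval₂Hom_C _ _
  have he_X : ∀ a : F.Index n, e (MvPolynomial.X a) = (E.map a.2.1.1.op).hom (F.ι a.2.2) :=
    MvPolynomial.eval₂Hom_X' _ _
  refine ⟨(MvPolynomial.eval₂Hom f val).comp e.symm.toRingHom, ⟨fun r => ?_, fun a => ?_⟩,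
    fun θ hθ => ?_⟩
  · simp [← he_C]
  · simp [← he_X]
  · have hcomp : θ.comp e.toRingHom = MvPolynomial.eval₂Hom f val :=
      MvPolynomial.ringHom_ext (by simpa [he_C] using hθ.1) (by simpa [he_X] using hθ.2)
    ext z
    simp [← hcomp]

theorem hom_ext_one {S : Type*} [CommRing S] {f g : E _⦋1⦌ →+* S}
    (h₀ : ∀ r, f (degen E (0 : Fin 1) r) = g (degen E (0 : Fin 1) r))
    (h₁ : ∀ x : F.gen 0, f (F.ι x) = g (F.ι x)) : f = g := by
  refine (F.existsUnique_hom 1 (g.comp (degen E (0 : Fin 1)).toRingHom)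
    fun a => g ((E.map a.2.1.1.op).hom (F.ι a.2.2))).unique ⟨fun r => ?_, ?_⟩ ⟨fun r => ?_, ?_⟩
  · rw [map_const_one]
    exact h₀ r
  · refine F.index_one_cases fun x _ => ?_
    simpa only [map_id_op_apply] using h₁ x
  · rw [map_const_one]
    rfl
  · exact fun _ => rfl

theorem hom_ext_two {S : Type*} [CommRing S] {f g : E _⦋2⦌ →+* S}
    (h₁ : ∀ a, f (degen E (1 : Fin 2) a) = g (degen E (1 : Fin 2) a))
    (h₀ : ∀ a, f (degen E (0 : Fin 2) a) = g (degen E (0 : Fin 2) a))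
    (ht : ∀ x : F.gen 1, f (F.ι x) = g (F.ι x)) : f = g := by
  refine (F.existsUnique_hom 2
    (g.comp ((degen E (0 : Fin 2)).comp (degen E (0 : Fin 1))).toRingHom)
    fun a => g ((E.map a.2.1.1.op).hom (F.ι a.2.2))).unique ⟨fun r => ?_, ?_⟩ ⟨fun r => ?_, ?_⟩
  · rw [map_const_two]
    exact h₀ _
  · refine F.index_two_cases (fun x _ => h₀ _) (fun x _ => h₁ _) fun x _ => ?_
    simpa only [map_id_op_apply] using ht x
  · rw [map_const_two]
    rfl
  · exact fun _ => rfl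

theorem exists_hom_two {S : Type*} [CommRing S] (α β : E _⦋1⦌ →+* S) (γ : F.gen 1 → S)
    (h : ∀ r, α (degen E (0 : Fin 1) r) = β (degen E (0 : Fin 1) r)) :
    ∃ θ : E _⦋2⦌ →+* S, (∀ a, θ (degen E (1 : Fin 2) a) = α a) ∧
      (∀ a, θ (degen E (0 : Fin 2) a) = β a) ∧ ∀ x, θ (F.ι x) = γ x := by
  classical
  let val (a : F.Index 2) : S := match a with
    | ⟨0, s, x⟩ => if s.1 = SimplexCategory.σ (1 : Fin 2) then α (F.ι x) else β (F.ι x)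
    | ⟨1, _, x⟩ => γ x
    | ⟨_ + 2, _⟩ => 0
  obtain ⟨θ, ⟨hr, hval⟩, -⟩ :=
    F.existsUnique_hom 2 (α.comp (degen E (0 : Fin 1)).toRingHom) val
  simp only [map_const_two] at hr
  refine ⟨θ, fun a => congrArg (· a) (F.hom_ext_one
    (f := θ.comp (degen E (1 : Fin 2)).toRingHom) (fun r => ?_) fun x => ?_),
    fun a => congrArg (· a) (F.hom_ext_one
    (f := θ.comp (degen E (0 : Fin 2)).toRingHom) (fun r => ?_) fun x => ?_), fun x => ?_⟩
  · exact (congrArg θ (degen_one_degen_zero E r)).trans (hr r)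
  · exact (hval ⟨0, ⟨SimplexCategory.σ (1 : Fin 2), inferInstance⟩, x⟩).trans (if_pos rfl)
  · exact (hr r).trans (h r)
  · exact (hval ⟨0, ⟨SimplexCategory.σ (0 : Fin 2), inferInstance⟩, x⟩).trans
      (if_neg σ_zero_ne_σ_one)
  · simpa only [map_id_op_apply] using hval ⟨1, ⟨𝟙 ⦋2⦌, inferInstance⟩, x⟩

end FreeData

section Skeleton

variable {k : Type u} [CommRing k] {E : SimplicialObject (CommAlgCat.{v} k)}

theorem skeleton_mem_of_degen_mem {j n : ℕ} (hj : j ≤ n) (H : Subring (skeleton E j _⦋n + 1⦌))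
    (h : ∀ (a : Fin (n + 1)) (y : skeleton E j _⦋n⦌), degen (skeleton E j) a y ∈ H)
    (z : skeleton E j _⦋n + 1⦌) : z ∈ H := by
  suffices hle : skeletonAlg E j (op ⦋n + 1⦌) ≤
      { (H.map (skeletonAlg E j (op ⦋n + 1⦌)).val.toRingHom) with
        algebraMap_mem' := fun c => ⟨degen (skeleton E j) 0 (algebraMap k _ c), h 0 _,
          (degen E 0).commutes c⟩ } by
    obtain ⟨w, hw, hwz⟩ := hle z.2
    rwa [← Subtype.ext hwz]
  refine Algebra.adjoin_le ?_
  rintro _ ⟨i, hi, s, y, rfl⟩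
  obtain ⟨a, s', rfl⟩ := exists_eq_σ_comp_of_le (hi.trans hj) s
  exact ⟨_, h a ⟨(E.map s'.op).hom y, Algebra.subset_adjoin ⟨i, hi, s', y, rfl⟩⟩,
    (map_comp_op_apply E _ s' y).symm⟩

/-- A simplex of dimension `i ≤ j`, in the `j`-skeleton, as a ring homomorphism. -/
def toSkeletonHom (E : SimplicialObject (CommAlgCat.{v} k)) {i j : ℕ} (h : i ≤ j) :
    E _⦋i⦌ →+* skeleton E j _⦋i⦌ where
  toFun := toSkeleton E h
  map_one' := rfl
  map_mul' _ _ := rfl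
  map_zero' := rfl
  map_add' _ _ := rfl

namespace FreeData

variable (F : FreeData E)

theorem exists_hom_skeleton_two {j : ℕ} (hj : 1 ≤ j) {S : Type*} [CommRing S]
    (α β : skeleton E j _⦋1⦌ →+* S) (γ : F.gen 1 → S)
    (h : ∀ r, α (degen (skeleton E j) (0 : Fin 1) r) = β (degen (skeleton E j) (0 : Fin 1) r)) :
    ∃ θ : skeleton E j _⦋2⦌ →+* S, (∀ a, θ (degen (skeleton E j) (1 : Fin 2) a) = α a) ∧
      (∀ a, θ (degen (skeleton E j) (0 : Fin 2) a) = β a) ∧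
      ∀ (x : F.gen 1) (hx : F.ι x ∈ skeletonAlg E j (op ⦋2⦌)), θ ⟨F.ι x, hx⟩ = γ x := by
  obtain ⟨θ, h₁, h₀, ht⟩ := F.exists_hom_two (α.comp (toSkeletonHom E hj))
    (β.comp (toSkeletonHom E hj)) γ fun r => h (toSkeleton E j.zero_le r)
  exact ⟨θ.comp (skeletonAlg E j (op ⦋2⦌)).val.toRingHom, fun a => h₁ a.1, fun a => h₀ a.1,
    fun x _ => ht x⟩

include F in
theorem isFreeInDegreeTwo_skeleton_one :
    IsFreeInDegreeTwo (skeleton E 1) (PEmpty.elim : PEmpty.{v + 1} → skeleton E 1 _⦋2⦌) where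
  mem_moore τ := τ.elim
  existsUnique_hom S _ α β γ h := by
    obtain ⟨θ, h₁, h₀, -⟩ := F.exists_hom_skeleton_two le_rfl α β 0 h
    refine ⟨θ, ⟨h₁, h₀, fun τ => τ.elim⟩, fun θ' ⟨h₁', h₀', _⟩ => RingHom.ext fun z => ?_⟩
    refine skeleton_mem_of_degen_mem le_rfl (θ'.eqLocus θ) (fun i y => ?_) z
    fin_cases i
    exacts [(h₀' y).trans (h₀ y).symm, (h₁' y).trans (h₁ y).symm]

theorem isFreeInDegreeTwo_skeleton_two : IsFreeInDegreeTwo (skeleton E 2) F.gen₂ where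
  mem_moore := F.gen₂_mem
  existsUnique_hom S _ α β γ h := by
    obtain ⟨θ, h₁, h₀, ht⟩ := F.exists_hom_skeleton_two one_le_two α β γ h
    refine ⟨θ, ⟨h₁, h₀, fun τ => ht τ _⟩, fun θ' ⟨h₁', h₀', ht'⟩ => RingHom.ext fun z => ?_⟩
    have hcomp : θ'.comp (toSkeletonHom E le_rfl) = θ.comp (toSkeletonHom E le_rfl) :=
      F.hom_ext_two (fun a => (h₁' (toSkeleton E one_le_two a)).trans (h₁ _).symm)
        (fun a => (h₀' (toSkeleton E one_le_two a)).trans (h₀ _).symm)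
        fun x => (ht' x).trans (ht x _).symm
    exact congrArg (· z.1) hcomp

end FreeData

end Skeleton

namespace C2

variable {k : Type u} [CommRing k] {X : SimplicialObject (CommAlgCat.{v} k)}
  {C : Type v} [NonUnitalCommRing C] [Module (X _⦋1⦌) C] [IsScalarTower (X _⦋1⦌) C C]
  [SMulCommClass (X _⦋1⦌) C C] {bdC : C →ₙₐ[X _⦋1⦌] X _⦋1⦌}
  (hJ : ∀ c, bdC c ∈ kerFace X 1) (hI : ∀ c, bdC c ∈ kerFace X 0)
  {g : C →ₙₐ[X _⦋1⦌] C2 X} (hg : ∀ c, bd X (g c) = bdC c)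

/-- The map `((Ker d₁ ⊗ Ker d₀) ⊔ C) / ∼ → NX₂ / ∂₃(NX₃ ∩ D₃)` induced by the pairing and by a map
of crossed modules defined on `C`. -/
def adjoinHom : Adjoin (kerFace X 1) (kerFace X 0) bdC hJ hI →ₙₐ[X _⦋1⦌] C2 X :=
  Adjoin.lift isCrossedModule (tensorHom X) g (bd_tensorHom X) hg
    (fun c n => by
      have hc : bd X (g c) ∈ kerFace X 0 := hg c ▸ hI c
      rw [map_smul, ← pairing_bd_left (g c) hc, tensorHom_tmul]
      exact congrArg (pairing X · n) (Subtype.ext (hg c).symm))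
    fun c m => by
      have hc : bd X (g c) ∈ kerFace X 1 := hg c ▸ hJ c
      rw [map_smul, ← pairing_bd_right (g c) hc, tensorHom_tmul]
      exact congrArg (pairing X m) (Subtype.ext (hg c).symm)

theorem adjoinHom_inl (s : kerFace X 1 ⊗[X _⦋1⦌] kerFace X 0) :
    adjoinHom hJ hI hg (Adjoin.inl _ _ bdC hJ hI s) = tensorHom X s :=
  Adjoin.lift_inl ..

theorem adjoinHom_inr (c : C) : adjoinHom hJ hI hg (Adjoin.inr _ _ bdC hJ hI c) = g c :=
  Adjoin.lift_inr ..

theorem bd_adjoinHom (z : Adjoin (kerFace X 1) (kerFace X 0) bdC hJ hI) :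
    bd X (adjoinHom hJ hI hg z) = Adjoin.bd (kerFace X 1) (kerFace X 0) bdC hJ hI z :=
  Adjoin.bd_lift ..

end C2

namespace IsFreeInDegreeTwo

variable {k : Type u} [CommRing k] {X : SimplicialObject (CommAlgCat.{v} k)}
  {T : Type v} {t : T → X _⦋2⦌} (P : IsFreeInDegreeTwo X t)

include P

theorem C2_mem_of_pairing_mem (H : AddSubgroup (C2 X)) (hp : ∀ x y, C2.pairing X x y ∈ H)
    (ht : ∀ (a : X _⦋1⦌) τ, a • C2.mk X (t τ) (P.mem_moore τ) ∈ H) (c : C2 X) : c ∈ H := by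
  obtain ⟨z, hz, rfl⟩ := C2.exists_mk_eq c
  let toQuot : C2 X →+ X _⦋2⦌ ⧸ boundaryIdeal X := (c2Ideal X).subtype.toAddMonoidHom
  have hle : (moore X 1).toAddSubgroup ≤
      (H.map toQuot).comap (Ideal.Quotient.mk (boundaryIdeal X)).toAddMonoidHom :=
    P.moore_le _ (fun w hw => ⟨0, zero_mem _, (Ideal.Quotient.eq_zero_iff_mem.2 hw).symm⟩)
      (fun x hx y hy => ⟨_, hp ⟨x, hx⟩ ⟨y, hy⟩, rfl⟩) fun a τ => ⟨_, ht a τ, rfl⟩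
  obtain ⟨c, hc, hcz⟩ := hle hz
  exact (Subtype.ext hcz : c = C2.mk X z hz) ▸ hc

section Retraction

variable {C : Type v} [NonUnitalCommRing C] [Module (X _⦋1⦌) C] [IsScalarTower (X _⦋1⦌) C C]
  [SMulCommClass (X _⦋1⦌) C C] {ι : T → C} {Q : Type*} [AddCommGroup Q]
  {i : kerFace X 1 ⊗[X _⦋1⦌] kerFace X 0 →+ Q} {j : C →+ Q}
  (hψ : (boundaryIdeal X).toAddSubgroup ≤ (P.retraction ι i j).ker)

theorem liftAddHom_retraction_tensorHom (s : kerFace X 1 ⊗[X _⦋1⦌] kerFace X 0) :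
    C2.liftAddHom (P.retraction ι i j) hψ (C2.tensorHom X s) = i s := by
  induction s with
  | zero => rw [map_zero, map_zero, map_zero]
  | add s s' hs hs' => rw [map_add, map_add, hs, hs', map_add]
  | tmul y x => exact P.retraction_pairing ι i j x y

variable {bdC : C →ₙₐ[X _⦋1⦌] X _⦋1⦌} (hC : IsCrossedModule bdC)
  (hι : ∀ τ, bdC (ι τ) = face X (2 : Fin 3) (t τ))

include hC hι

theorem liftAddHom_retraction_smul_gen (a : X _⦋1⦌) (τ : T) :
    C2.liftAddHom (P.retraction ι i j) hψ (a • C2.mk X (t τ) (P.mem_moore τ)) = j (a • ι τ) := by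
  rw [C2.smul_mk, C2.liftAddHom_mk, mul_comm, P.retraction_gen_mul i j hC hι, face_two_degen_one]

end Retraction

theorem tensorHom_bijective [IsEmpty T] : Function.Bijective (C2.tensorHom X) := by
  have hψ : (boundaryIdeal X).toAddSubgroup ≤ (P.retraction (fun _ => PUnit.unit.{v + 1})
      (AddMonoidHom.id (kerFace X 1 ⊗[X _⦋1⦌] kerFace X 0)) 0).ker :=
    P.boundaryIdeal_le_ker_retraction (bdC := 0) (fun _ _ => rfl) isEmptyElim
      (fun _ => zero_mem _) (fun _ => zero_mem _) (fun _ n => TensorProduct.tmul_zero _ n)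
      fun _ m => TensorProduct.zero_tmul _ m
  refine ⟨Function.LeftInverse.injective (P.liftAddHom_retraction_tensorHom hψ), fun c => ?_⟩
  exact P.C2_mem_of_pairing_mem (AddMonoidHomClass.toAddMonoidHom (C2.tensorHom X)).range
    (fun x y => ⟨y ⊗ₜ x, rfl⟩) (fun _ => isEmptyElim) c

section Adjoin

variable {C : Type v} [NonUnitalCommRing C] [Module (X _⦋1⦌) C] {bdC : C →ₙₐ[X _⦋1⦌] X _⦋1⦌}
  {ι : T → C}

theorem exists_hom_C2 (hC : IsFreeCrossedModule (fun τ => face X (Fin.last 2) (t τ)) bdC ι) :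
    ∃ g : C →ₙₐ[X _⦋1⦌] C2 X, (∀ c, C2.bd X (g c) = bdC c) ∧
      ∀ τ, g (ι τ) = C2.mk X (t τ) (P.mem_moore τ) :=
  (hC.2.2 (C2 X) (C2.bd X) (fun τ => C2.mk X (t τ) (P.mem_moore τ)) C2.isCrossedModule
    fun _ => rfl).exists

variable [IsScalarTower (X _⦋1⦌) C C] [SMulCommClass (X _⦋1⦌) C C]
  (hJ : ∀ c, bdC c ∈ kerFace X 1) (hI : ∀ c, bdC c ∈ kerFace X 0)
  {g : C →ₙₐ[X _⦋1⦌] C2 X} (hg : ∀ c, C2.bd X (g c) = bdC c)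
  (hgι : ∀ τ, g (ι τ) = C2.mk X (t τ) (P.mem_moore τ))

include hgι

theorem adjoinHom_surjective : Function.Surjective (C2.adjoinHom hJ hI hg) := fun c =>
  P.C2_mem_of_pairing_mem (AddMonoidHomClass.toAddMonoidHom (C2.adjoinHom hJ hI hg)).range
    (fun x y => ⟨_, C2.adjoinHom_inl hJ hI hg (y ⊗ₜ x)⟩)
    (fun a τ => ⟨_, (C2.adjoinHom_inr hJ hI hg (a • ι τ)).trans (by rw [map_smul, hgι])⟩) c

variable (hC : IsFreeCrossedModule (fun τ => face X (Fin.last 2) (t τ)) bdC ι)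

include hC

theorem adjoinHom_injective : Function.Injective (C2.adjoinHom hJ hI hg) := by
  have hψ : (boundaryIdeal X).toAddSubgroup ≤
      (P.retraction ι (Adjoin.inlAddHom hJ hI) (Adjoin.inrAddHom hJ hI)).ker :=
    P.boundaryIdeal_le_ker_retraction hC.1 hC.2.1 hJ hI (Adjoin.inl_tmul_bd hJ hI)
      (Adjoin.inl_bd_tmul hJ hI)
  have hgen (c : C) : C2.liftAddHom _ hψ (g c) = Adjoin.inr _ _ bdC hJ hI c := by
    induction hC.mem_span c using Submodule.closure_induction with
    | zero => rw [map_zero, map_zero]; rfl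
    | add c d _ _ hc hd =>
      rw [map_add, map_add, hc, hd]
      exact (map_add (Adjoin.inrAddHom hJ hI) c d).symm
    | smul_mem a c hc =>
      obtain ⟨τ, rfl⟩ := hc
      rw [map_smul, hgι]
      exact P.liftAddHom_retraction_smul_gen hψ hC.1 hC.2.1 a τ
  refine Function.LeftInverse.injective (g := C2.liftAddHom _ hψ) fun z => ?_
  obtain ⟨s, c, rfl⟩ := Adjoin.exists_inl_add_inr hJ hI z
  rw [map_add, map_add, C2.adjoinHom_inl, C2.adjoinHom_inr, hgen,
    P.liftAddHom_retraction_tensorHom hψ]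
  rfl

omit hgι in
theorem exists_adjoin_hom_bijective :
    ∃ (hJ : ∀ c, bdC c ∈ kerFace X 1) (hI : ∀ c, bdC c ∈ kerFace X 0)
      (φ : Adjoin (kerFace X 1) (kerFace X 0) bdC hJ hI →ₙₐ[X _⦋1⦌] C2 X),
      Function.Bijective φ ∧
      (∀ z, C2.bd X (φ z) = Adjoin.bd (kerFace X 1) (kerFace X 0) bdC hJ hI z) ∧
      (∀ y x, φ (Adjoin.inl _ _ bdC hJ hI (y ⊗ₜ x)) = C2.pairing X x y) ∧
      ∀ τ, φ (Adjoin.inr _ _ bdC hJ hI (ι τ)) = C2.mk X (t τ) (P.mem_moore τ) := by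
  obtain ⟨g, hg, hgι⟩ := P.exists_hom_C2 hC
  have hJ : ∀ c, bdC c ∈ kerFace X 1 := fun c => hg c ▸ C2.face_one_bd (g c)
  have hI : ∀ c, bdC c ∈ kerFace X 0 := fun c => hg c ▸ C2.face_zero_bd (g c)
  exact ⟨hJ, hI, C2.adjoinHom hJ hI hg,
    ⟨P.adjoinHom_injective hJ hI hg hgι hC, P.adjoinHom_surjective hJ hI hg hgι⟩,
    C2.bd_adjoinHom hJ hI hg, fun y x => C2.adjoinHom_inl hJ hI hg (y ⊗ₜ x),
    fun τ => (C2.adjoinHom_inr hJ hI hg (ι τ)).trans (hgι τ)⟩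

end Adjoin

end IsFreeInDegreeTwo

end SimpAlg

theorem mainTheorem7 {k : Type u} [CommRing k] (E : SimplicialObject (CommAlgCat.{v} k))
    (F : SimpAlg.FreeData E) :
    (∃ φ : (SimpAlg.kerFace (SimpAlg.skeleton E 1) 1 ⊗[SimpAlg.skeleton E 1 _⦋1⦌]
          SimpAlg.kerFace (SimpAlg.skeleton E 1) 0) →ₙₐ[SimpAlg.skeleton E 1 _⦋1⦌]
          SimpAlg.C2 (SimpAlg.skeleton E 1),
        Function.Bijective φ ∧
        (∀ t, SimpAlg.C2.bd (SimpAlg.skeleton E 1) (φ t) =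
          SimpAlg.idealTensorBd (SimpAlg.kerFace (SimpAlg.skeleton E 1) 1)
            (SimpAlg.kerFace (SimpAlg.skeleton E 1) 0) t) ∧
        ∀ (y : SimpAlg.kerFace (SimpAlg.skeleton E 1) 1)
          (x : SimpAlg.kerFace (SimpAlg.skeleton E 1) 0),
          φ (y ⊗ₜ x) = SimpAlg.C2.pairing (SimpAlg.skeleton E 1) x y) ∧
    ∀ (C : Type v) [NonUnitalCommRing C] [Module (SimpAlg.skeleton E 2 _⦋1⦌) C]
      [IsScalarTower (SimpAlg.skeleton E 2 _⦋1⦌) C C]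
      [SMulCommClass (SimpAlg.skeleton E 2 _⦋1⦌) C C]
      (bdC : C →ₙₐ[SimpAlg.skeleton E 2 _⦋1⦌] SimpAlg.skeleton E 2 _⦋1⦌) (ι : F.gen 1 → C),
      SimpAlg.IsFreeCrossedModule
        (fun t => SimpAlg.face (SimpAlg.skeleton E 2) (Fin.last 2) (F.gen₂ t)) bdC ι →
      ∃ (hJ : ∀ c, bdC c ∈ SimpAlg.kerFace (SimpAlg.skeleton E 2) 1)
        (hI : ∀ c, bdC c ∈ SimpAlg.kerFace (SimpAlg.skeleton E 2) 0)
        (φ : SimpAlg.Adjoin (SimpAlg.kerFace (SimpAlg.skeleton E 2) 1)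
            (SimpAlg.kerFace (SimpAlg.skeleton E 2) 0) bdC hJ hI →ₙₐ[SimpAlg.skeleton E 2 _⦋1⦌]
            SimpAlg.C2 (SimpAlg.skeleton E 2)),
        Function.Bijective φ ∧
        (∀ t, SimpAlg.C2.bd (SimpAlg.skeleton E 2) (φ t) =
          SimpAlg.Adjoin.bd (SimpAlg.kerFace (SimpAlg.skeleton E 2) 1)
            (SimpAlg.kerFace (SimpAlg.skeleton E 2) 0) bdC hJ hI t) ∧
        (∀ (y : SimpAlg.kerFace (SimpAlg.skeleton E 2) 1)
          (x : SimpAlg.kerFace (SimpAlg.skeleton E 2) 0),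
          φ (SimpAlg.Adjoin.inl _ _ bdC hJ hI (y ⊗ₜ x)) =
            SimpAlg.C2.pairing (SimpAlg.skeleton E 2) x y) ∧
        ∀ t : F.gen 1, φ (SimpAlg.Adjoin.inr _ _ bdC hJ hI (ι t)) =
          SimpAlg.C2.mk (SimpAlg.skeleton E 2) (F.gen₂ t) (F.gen₂_mem t) := by
  refine ⟨⟨SimpAlg.C2.tensorHom _, F.isFreeInDegreeTwo_skeleton_one.tensorHom_bijective,
    SimpAlg.C2.bd_tensorHom _, fun y x => SimpAlg.C2.tensorHom_tmul _ y x⟩, ?_⟩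
  intro C _ _ _ _ bdC ι hC
  exact F.isFreeInDegreeTwo_skeleton_two.exists_adjoin_hom_bijective hC
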